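/- Let $n\ge 1$, let $M\subset\mathbb{R}^n$ be compact and convex, and let $m$ be a probability measure on $\mathbb{R}^n$ that is absolutely continuous with respect to Lebesgue measure and has topological support $M$. For $\varphi:M\to\mathbb{R}$ put $\varphi^{\mathfrak c}(x)=-\inf_{y\in M}\left[\tfrac12|x-y|^2+\varphi(y)\right]$; call $\varphi$ *$d^2/2$-convex* if $\varphi=\psi^{\mathfrak c}$ on $M$ for some $\psi:M\to\mathbb{R}$. For a probability measure $\mu$ on $M$, an *optimal transport map* from $m$ to $\mu$ is a Borel map $g:M\to M$ with $g_*m=\mu$ that minimizes $\int|x-h(x)|^2\,m(dx)$ among all Borel maps $h:M\to M$ with $h_*m=\mu$. A measure $\nu$ is called a *conjugate measure* $\mu^{\mathfrak c}$ of $\mu$ if there is a $d^2/2$-convex $\varphi$ with $(\mathrm{Id}+\nabla\varphi)_*m=\mu$ and $(\mathrm{Id}+\nabla\varphi^{\mathfrak c})_*m=\nu$. Let $I$ be a finite or countably infinite index set, let $z_i\in M$ $(i\in I)$ be pairwise distinct, let $\lambda_i\ge0$ with $\sum_{i\in I}\lambda_i=1$, and put $\mu=\sum_{i\in I}\lambda_i\delta_{z_i}$.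 For numbers $\alpha_i\in\mathbb{R}$ with $\sup_i\alpha_i<\infty$ put $$\varphi_1(x)=\sup_{i\in I}\left[\langle z_i,x\rangle+\alpha_i\right],\qquad A_i=\{x\in\mathbb{R}^n:\varphi_1(x)=\langle z_i,x\rangle+\alpha_i\},\qquad U_i=\text{the interior of } M\cap A_i .$$ Then an optimal transport map from $m$ to $\mu$ exists, a conjugate measure $\mu^{\mathfrak c}$ exists, and there are numbers $\alpha_i$ with $\sup_i\alpha_i<\infty$ such that $m(A_i)=\lambda_i$ for all $i$. Moreover, for every such choice of the $\alpha_i$: (i) The sets $U_i\subset M$ are open, convex and pairwise disjoint, and $m(U_i)=\lambda_i$. (ii) The function $\varphi_1-\tfrac12|\cdot|^2$ is $d^2/2$-convex on $M$, and $\nabla\varphi_1=z_i$ everywhere on $U_i$. Every optimal transport map $g$ from $m$ to $\mu$ satisfies $g=\nabla\varphi_1$ $m$-a.e.; in particular $g=z_i$ $m$-a.e. on $U_i$ for each $i$. (iii) The set $M\setminus\bigcup_iU_i$ is compact and $m$-null, and every conjugate measure $\mu^{\mathfrak c}$ of $\mu$ is a probability measure with $\mu^{\mathfrak c}\left(\mathbb{R}^n\setminus(M\setminus\bigcup_iU_i)\right)=0$.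 (iv) If $I$ is finite, then each $A_i$ is a (possibly unbounded) convex polytope, i.e. an intersection of finitely many closed half-spaces. The $A_i$ form a Laguerre tessellation of $\mathbb{R}^n$ with sites $z_i$: there are $r_i\ge0$ with $A_i=\{x:|x-z_i|^2-r_i^2\le|x-z_j|^2-r_j^2\text{ for all }j\in I\}$, the $A_i$ cover $\mathbb{R}^n$ and have pairwise disjoint interiors, and $A_i$ has non-empty interior whenever $\lambda_i>0$. Finally, $M\setminus\bigcup_iU_i$ has finite $(n-1)$-dimensional Hausdorff measure. -/

import Mathlib

open MeasureTheory
open scoped ENNReal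

noncomputable section

namespace ConjugationMap

variable {E : Type*} [NormedAddCommGroup E] [InnerProductSpace ℝ E]

/-- The conjugate (generalized Legendre transform) of `φ` over `M`:
`φᶜ(x) = - inf_{y ∈ M} [d(x,y)²/2 + φ(y)]`. Only the values of `φ` on `M` enter. -/
def conj (M : Set E) (φ : E → ℝ) (x : E) : ℝ :=
  -sInf ((fun y => dist x y ^ 2 / 2 + φ y) '' M)

/-- `φ` is `d²/2`-convex on `M`: for some real function `ψ` on `M`,
`φ(x) = - inf_{y ∈ M} [d(x,y)²/2 + ψ(y)]` for all `x ∈ M` (in particular the infimum is finite).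
Values of `φ` and `ψ` off `M` are irrelevant. -/
def IsDSqConvex (M : Set E) (φ : E → ℝ) : Prop :=
  ∃ ψ : E → ℝ, ∀ x ∈ M, IsGLB ((fun y => dist x y ^ 2 / 2 + ψ y) '' M) (-φ x)

/-- The map `exp(∇φ)`, which is `x ↦ x + ∇φ(x)` in a Euclidean space. It is used only up to null
sets of a measure that charges neither the boundary of `M` nor the points at which a
`d²/2`-convex function is not differentiable. -/
def expGrad [CompleteSpace E] (φ : E → ℝ) (x : E) : E :=
  x + gradient φ x

/-- `g` is an optimal transport map from `m` to `μ`: a Borel map `M → M` with `g_* m = μ` which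
minimizes `∫ d(x, h(x))² m(dx)` among all Borel maps `h : M → M` with `h_* m = μ`. -/
structure IsOptimalTransportMap [MeasurableSpace E] (M : Set E) (m μ : Measure E) (g : E → E) :
    Prop where
  measurable : Measurable g
  mapsTo : Set.MapsTo g M M
  map_eq : m.map g = μ
  optimal : ∀ h : E → E, Measurable h → Set.MapsTo h M M → m.map h = μ →
    ∫ x, dist x (g x) ^ 2 ∂m ≤ ∫ x, dist x (h x) ^ 2 ∂m

/-- `ν` is the conjugate measure `μᶜ` of `μ` with respect to the reference measure `m` on `M`:
`μ = exp(∇φ)_* m` and `ν = exp(∇φᶜ)_* m` for a `d²/2`-convex function `φ` on `M`. -/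
def IsConjugateMeasure [CompleteSpace E] [MeasurableSpace E] (M : Set E) (m μ ν : Measure E) :
    Prop :=
  ∃ φ : E → ℝ, IsDSqConvex M φ ∧ m.map (expGrad φ) = μ ∧ m.map (expGrad (conj M φ)) = ν

/-- The discrete measure `∑ i, w i • δ_{z i}`. -/
def discreteMeasure [MeasurableSpace E] {ι : Type*} (z : ι → E) (w : ι → ℝ≥0∞) : Measure E :=
  Measure.sum fun i => w i • Measure.dirac (z i)

/-- `φ₁(x) = sup_i [⟨z i, x⟩ + α i]`. -/
def supAffine {ι : Type*} (z : ι → E) (α : ι → ℝ) (x : E) : ℝ :=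
  ⨆ i, (inner ℝ (z i) x + α i)

/-- `A i = {x : φ₁(x) = ⟨z i, x⟩ + α i}`. -/
def contactSet {ι : Type*} (z : ι → E) (α : ι → ℝ) (i : ι) : Set E :=
  {x | supAffine z α x = inner ℝ (z i) x + α i}

/-- `U i`, the interior of `M ∩ A i`. -/
def openCell {ι : Type*} (M : Set E) (z : ι → E) (α : ι → ℝ) (i : ι) : Set E :=
  interior (M ∩ contactSet z α i)

/-- A (possibly unbounded) convex polytope: an intersection of finitely many closed
half-spaces. -/
def IsConvexPolytope (A : Set E) : Prop :=
  ∃ s : Finset (E × ℝ), (∀ p ∈ s, p.1 ≠ 0) ∧ A = {x | ∀ p ∈ s, inner ℝ p.1 x ≤ p.2}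

/-- The sets `A i` form the Laguerre tessellation of the space with sites `z i`, for suitable
radii `r i ≥ 0`: `A i` consists of the points whose power distance `‖x - z j‖² - (r j)²` is
minimal for `j = i`; the cells cover the space and have disjoint interiors. -/
structure IsLaguerreTessellation {ι : Type*} (z : ι → E) (A : ι → Set E) : Prop where
  cells : ∃ r : ι → ℝ, (∀ i, 0 ≤ r i) ∧
    ∀ i, A i = {x | ∀ j, ‖x - z i‖ ^ 2 - r i ^ 2 ≤ ‖x - z j‖ ^ 2 - r j ^ 2}
  cover : ⋃ i, A i = Set.univ
  disjoint : Pairwise fun i j => Disjoint (interior (A i)) (interior (A j))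

end ConjugationMap

end

/-!
Adding `|·|²/2` to the potentials turns `d²/2`-conjugation over `M` into the Legendre transform over
`M`: a `d²/2`-convex function corresponds to a pair `(f, c)` with `f x + c y ≥ ⟪x, y⟫` on `M × M`
and equality attained in each row and column. Integrating this inequality along a transport map
shows that the maps optimal for the quadratic cost are exactly the gradients `∇f`, and that the
image measure of `m` under `∇f` determines `∇f` almost everywhere.

Numbers `α i` with prescribed masses come from minimizing the convex dual cost
`∫ φ₁ ∂m - ∑ w i * α i`. Each `α i` may be replaced by the largest value that does not change `φ₁`
on `M`, which makes `α i` a Lipschitz function of `z i` and yields a minimizer by compactness.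
Raising a single `α i` by `t` and letting `t → 0` gives `w i ≤ m (A i)`, and the total masses agree.

On `U i` the potential `φ₁` is affine with slope `z i`, so a point of `U i` can be the gradient of
the conjugate potential only at `z i`; as `m` has no atoms, the conjugate measure does not charge
`U i`. With finitely many sites, what is left of `M` lies in the union of the frontiers of finitely
many compact convex sets, and the frontier of such a set is contained in the image of the boundary
of a cube under the nearest-point projection, which is `1`-Lipschitz.
-/

namespace ConjugationMap

open Set Filter Topology
open scoped InnerProductSpace NNReal

section Affine

variable {E : Type*} [NormedAddCommGroup E] [InnerProductSpace ℝ E] {ι : Type*}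
  {z : ι → E} {α : ι → ℝ} {M : Set E}

lemma bddAbove_range_inner_add (hz : Bornology.IsBounded (range z)) (hα : BddAbove (range α))
    (x : E) : BddAbove (range fun i => ⟪z i, x⟫_ℝ + α i) := by
  obtain ⟨R, hR⟩ := hz.exists_norm_le
  obtain ⟨C, hC⟩ := hα
  refine ⟨R * ‖x‖ + C, forall_mem_range.2 fun i => ?_⟩
  exact add_le_add ((real_inner_le_norm _ _).trans (by gcongr; exact hR _ (mem_range_self i)))
    (hC (mem_range_self i))

lemma supAffine_le [Nonempty ι] {x : E} {c : ℝ} (h : ∀ i, ⟪z i, x⟫_ℝ + α i ≤ c) :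
    supAffine z α x ≤ c :=
  ciSup_le h

section Bounded

variable (h : ∀ x, BddAbove (range fun i => ⟪z i, x⟫_ℝ + α i))
include h

lemma le_supAffine (x : E) (i : ι) : ⟪z i, x⟫_ℝ + α i ≤ supAffine z α x :=
  le_ciSup (h x) i

lemma mem_contactSet_iff {x : E} {i : ι} :
    x ∈ contactSet z α i ↔ ∀ j, ⟪z j, x⟫_ℝ + α j ≤ ⟪z i, x⟫_ℝ + α i := by
  have : Nonempty ι := ⟨i⟩
  refine ⟨fun hx j => (le_supAffine h x j).trans_eq hx, fun hx => ?_⟩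
  exact le_antisymm (supAffine_le hx) (le_supAffine h x i)

lemma contactSet_eq_iInter (i : ι) :
    contactSet z α i = ⋂ j, {x | ⟪z j - z i, x⟫_ℝ ≤ α i - α j} := by
  ext x
  simp only [mem_contactSet_iff h, mem_iInter, mem_ofPred_eq, inner_sub_left]
  exact forall_congr' fun j => by constructor <;> intro hj <;> linarith

lemma isClosed_contactSet (i : ι) : IsClosed (contactSet z α i) := by
  rw [contactSet_eq_iInter h]
  exact isClosed_iInter fun j => isClosed_le (by fun_prop) continuous_const

lemma convex_contactSet (i : ι) : Convex ℝ (contactSet z α i) := by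
  rw [contactSet_eq_iInter h]
  exact convex_iInter fun j => convex_halfSpace_le (innerₛₗ ℝ (z j - z i)).isLinear _

lemma lipschitzWith_supAffine {R : ℝ≥0} (hz : ∀ i, ‖z i‖ ≤ R) :
    LipschitzWith R (supAffine z α) := by
  refine LipschitzWith.of_le_add_mul R fun x y => ?_
  cases isEmpty_or_nonempty ι
  · simp only [supAffine, Real.iSup_of_isEmpty, zero_add]
    positivity
  refine supAffine_le fun i => ?_
  have hxy : ⟪z i, x - y⟫_ℝ ≤ R * ‖x - y‖ :=
    (real_inner_le_norm _ _).trans (by gcongr; exact hz i)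
  rw [inner_sub_right] at hxy
  rw [dist_eq_norm]
  linarith [le_supAffine h y i]

end Bounded

lemma continuous_supAffine (hz : Bornology.IsBounded (range z)) (hα : BddAbove (range α)) :
    Continuous (supAffine z α) := by
  obtain ⟨R, hR, hzR⟩ := hz.exists_pos_norm_le
  exact (lipschitzWith_supAffine (bddAbove_range_inner_add hz hα) (R := ⟨R, hR.le⟩)
    fun i => hzR _ (mem_range_self i)).continuous

lemma isOpen_openCell (i : ι) : IsOpen (openCell M z α i) := isOpen_interior

lemma openCell_subset (i : ι) : openCell M z α i ⊆ M :=
  interior_subset.trans inter_subset_left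

lemma openCell_subset_contactSet (i : ι) : openCell M z α i ⊆ contactSet z α i :=
  interior_subset.trans inter_subset_right

lemma convex_openCell (hM : Convex ℝ M) (h : ∀ x, BddAbove (range fun i => ⟪z i, x⟫_ℝ + α i))
    (i : ι) : Convex ℝ (openCell M z α i) :=
  (hM.inter (convex_contactSet h i)).interior

lemma hasFDerivAt_inner_left (y x : E) :
    HasFDerivAt (fun x => ⟪y, x⟫_ℝ) (innerSL ℝ y) x :=
  (innerSL ℝ y).hasFDerivAt

lemma eq_of_inner_add_le_of_mem_interior {A : Set E} {x y y' : E} {c c' : ℝ}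
    (hx : x ∈ interior A) (hle : ∀ x' ∈ A, ⟪y, x'⟫_ℝ + c ≤ ⟪y', x'⟫_ℝ + c')
    (heq : ⟪y, x⟫_ℝ + c = ⟪y', x⟫_ℝ + c') : y = y' := by
  have hmax : IsLocalMax (fun x' => ⟪y, x'⟫_ℝ - ⟪y', x'⟫_ℝ) x := by
    filter_upwards [mem_interior_iff_mem_nhds.1 hx] with x' hx'
    linarith [hle x' hx']
  have hzero := hmax.hasFDerivAt_eq_zero
    ((hasFDerivAt_inner_left y x).sub (hasFDerivAt_inner_left y' x))
  rw [sub_eq_zero] at hzero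
  exact ext_inner_right ℝ fun v => congrArg (· v) hzero

lemma pairwise_disjoint_interior_contactSet (hz : Function.Injective z)
    (h : ∀ x, BddAbove (range fun i => ⟪z i, x⟫_ℝ + α i)) :
    Pairwise fun i j =>
      Disjoint (interior (contactSet z α i)) (interior (contactSet z α j)) := by
  intro i j hij
  refine Set.disjoint_left.2 fun x hi hj => hij (hz ?_)
  refine eq_of_inner_add_le_of_mem_interior hj (fun x' hx' => (mem_contactSet_iff h).1 hx' i) ?_
  have hxi : supAffine z α x = ⟪z i, x⟫_ℝ + α i := interior_subset (s := contactSet z α i) hi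
  have hxj : supAffine z α x = ⟪z j, x⟫_ℝ + α j := interior_subset (s := contactSet z α j) hj
  exact hxi.symm.trans hxj

lemma pairwise_disjoint_openCell (hz : Function.Injective z)
    (h : ∀ x, BddAbove (range fun i => ⟪z i, x⟫_ℝ + α i)) :
    Pairwise fun i j => Disjoint (openCell M z α i) (openCell M z α j) :=
  (pairwise_disjoint_interior_contactSet hz h).mono fun _ _ hij =>
    hij.mono (interior_mono inter_subset_right) (interior_mono inter_subset_right)

lemma hasGradientAt_inner_add [CompleteSpace E] (y x : E) (c : ℝ) :
    HasGradientAt (fun x => ⟪y, x⟫_ℝ + c) y x :=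
  hasGradientAt_iff_hasFDerivAt.2 ((hasFDerivAt_inner_left y x).add_const c)

lemma hasGradientAt_supAffine [CompleteSpace E] {i : ι} {x : E} (hx : x ∈ openCell M z α i) :
    HasGradientAt (supAffine z α) (z i) x :=
  (hasGradientAt_inner_add (z i) x (α i)).congr_of_eventuallyEq <| by
    filter_upwards [(isOpen_openCell i).mem_nhds hx] with y hy
    exact openCell_subset_contactSet i hy

end Affine

section LegendrePairs

lemma isBounded_range_coe {X : Type*} [Bornology X] {s : Set X} (hs : Bornology.IsBounded s) :
    Bornology.IsBounded (range ((↑) : s → X)) := by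
  rwa [Subtype.range_coe]

lemma bddAbove_range_neg {X : Type*} [TopologicalSpace X] {s : Set X} {f : X → ℝ}
    (hs : IsCompact s) (hf : ContinuousOn f s) : BddAbove (range fun x : s => -f x) := by
  have := hs.bddAbove_image hf.neg
  rwa [image_eq_range] at this

variable {E : Type*} [NormedAddCommGroup E] [InnerProductSpace ℝ E] {M : Set E}

lemma sq_dist_half (x y : E) :
    dist x y ^ 2 / 2 = ‖x‖ ^ 2 / 2 + ‖y‖ ^ 2 / 2 - ⟪x, y⟫_ℝ := by
  rw [dist_eq_norm, norm_sub_sq_real]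
  ring

/-- The Legendre transform `y ↦ sup_{x ∈ M} [⟪x, y⟫ - f x]` of the restriction of `f` to `M`. -/
noncomputable def legendre (M : Set E) (f : E → ℝ) : E → ℝ :=
  supAffine ((↑) : M → E) fun x => -f x

/-- `f` and `c` are Legendre transforms of each other on `M`, with all suprema attained. For the
cost `d²/2` this is the relation between `φ + |·|²/2` and `φᶜ + |·|²/2`. -/
structure IsLegendrePair (M : Set E) (f c : E → ℝ) : Prop where
  inner_le : ∀ x ∈ M, ∀ y ∈ M, ⟪x, y⟫_ℝ ≤ f x + c y
  exists_right : ∀ x ∈ M, ∃ y ∈ M, f x + c y = ⟪x, y⟫_ℝ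
  exists_left : ∀ y ∈ M, ∃ x ∈ M, f x + c y = ⟪x, y⟫_ℝ

lemma legendre_congr {f f' : E → ℝ} (h : EqOn f f' M) : legendre M f = legendre M f' := by
  have hcoe : (fun x : M => -f x) = fun x : M => -f' x :=
    funext fun x => congrArg Neg.neg (h x.2)
  rw [legendre, legendre, hcoe]

section Continuous

variable {f : E → ℝ} (hM : IsCompact M) (hf : ContinuousOn f M)
include hM hf

lemma continuous_legendre : Continuous (legendre M f) :=
  continuous_supAffine (isBounded_range_coe hM.isBounded) (bddAbove_range_neg hM hf)

lemma inner_le_add_legendre {x : E} (hx : x ∈ M) (y : E) :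
    ⟪x, y⟫_ℝ ≤ f x + legendre M f y := by
  have := le_supAffine (bddAbove_range_inner_add (isBounded_range_coe hM.isBounded)
    (bddAbove_range_neg hM hf)) y ⟨x, hx⟩
  rw [legendre]
  linarith

lemma exists_add_legendre_eq_inner (hne : M.Nonempty) (y : E) :
    ∃ x ∈ M, f x + legendre M f y = ⟪x, y⟫_ℝ := by
  have : Nonempty M := hne.to_subtype
  obtain ⟨x, hx, hmax⟩ := hM.exists_isMaxOn hne
    (ContinuousOn.sub (f := fun x => ⟪x, y⟫_ℝ) (by fun_prop) hf)
  refine ⟨x, hx, le_antisymm ?_ (inner_le_add_legendre hM hf hx y)⟩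
  have : legendre M f y ≤ ⟪x, y⟫_ℝ - f x := supAffine_le fun x' => hmax x'.2
  linarith

end Continuous

lemma isLegendrePair_supAffine (hM : IsCompact M) {ι : Type*} [Nonempty ι] {z : ι → E}
    {α : ι → ℝ} (hz : ∀ i, z i ∈ M) (hα : BddAbove (range α)) :
    IsLegendrePair M (supAffine z α) (legendre M (supAffine z α)) := by
  have hne : M.Nonempty := ⟨_, hz (Classical.arbitrary ι)⟩
  have hzb : Bornology.IsBounded (range z) := hM.isBounded.subset (range_subset_iff.2 hz)
  have hf := (continuous_supAffine hzb hα).continuousOn (s := M)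
  have hc := (continuous_legendre hM hf).continuousOn (s := M)
  refine ⟨fun x hx y _ => inner_le_add_legendre hM hf hx y, fun x hx => ?_,
    fun y _ => exists_add_legendre_eq_inner hM hf hne y⟩
  obtain ⟨y, hy, hyx⟩ := exists_add_legendre_eq_inner hM hc hne x
  refine ⟨y, hy, le_antisymm ?_ (inner_le_add_legendre hM hf hx y)⟩
  suffices supAffine z α x ≤ ⟪y, x⟫_ℝ - legendre M (supAffine z α) y by
    rw [real_inner_comm]
    linarith
  refine supAffine_le fun i => ?_
  obtain ⟨x', -, hx'⟩ := exists_add_legendre_eq_inner hM hf hne (z i)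
  have hi := le_supAffine (bddAbove_range_inner_add hzb hα) x' i
  have hzx := inner_le_add_legendre hM hc (hz i) x
  rw [real_inner_comm] at hi
  linarith

namespace IsLegendrePair

variable {f c f' c' : E → ℝ}

lemma symm (h : IsLegendrePair M f c) : IsLegendrePair M c f where
  inner_le x hx y hy := by
    rw [real_inner_comm, add_comm]
    exact h.inner_le y hy x hx
  exists_right x hx := by
    simpa only [add_comm (c x), real_inner_comm x] using h.exists_left x hx
  exists_left y hy := by
    simpa only [add_comm _ (f y), real_inner_comm _ y] using h.exists_right y hy

lemma congr (h : IsLegendrePair M f c) (hf : EqOn f f' M) (hc : EqOn c c' M) :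
    IsLegendrePair M f' c' where
  inner_le x hx y hy := by simpa only [hf hx, hc hy] using h.inner_le x hx y hy
  exists_right x hx := by
    obtain ⟨y, hy, hxy⟩ := h.exists_right x hx
    exact ⟨y, hy, by rwa [← hf hx, ← hc hy]⟩
  exists_left y hy := by
    obtain ⟨x, hx, hxy⟩ := h.exists_left y hy
    exact ⟨x, hx, by rwa [← hf hx, ← hc hy]⟩

lemma le_add_inner (h : IsLegendrePair M f c) {x x' y : E} (hx' : x' ∈ M) (hy : y ∈ M)
    (hxy : f x + c y = ⟪x, y⟫_ℝ) : f x + ⟪x' - x, y⟫_ℝ ≤ f x' := by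
  rw [inner_sub_left]
  linarith [h.inner_le x' hx' y hy]

lemma exists_lipschitzOnWith (h : IsLegendrePair M f c) (hM : Bornology.IsBounded M) :
    ∃ R, LipschitzOnWith R f M := by
  obtain ⟨R, hMR⟩ := hM.exists_norm_le
  refine ⟨R.toNNReal, LipschitzOnWith.of_le_add_mul' R fun x hx x' hx' => ?_⟩
  obtain ⟨y, hy, hxy⟩ := h.exists_right x hx
  have hsub : ⟪x - x', y⟫_ℝ ≤ R * dist x x' := by
    rw [mul_comm, dist_eq_norm]
    exact (real_inner_le_norm _ _).trans (by gcongr; exact hMR y hy)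
  have hle := h.le_add_inner hx' hy hxy
  rw [← neg_sub x x', inner_neg_left] at hle
  linarith

lemma continuousOn (h : IsLegendrePair M f c) (hM : Bornology.IsBounded M) : ContinuousOn f M :=
  (h.exists_lipschitzOnWith hM).choose_spec.continuousOn

lemma isDSqConvex (h : IsLegendrePair M f c) : IsDSqConvex M fun x => f x - ‖x‖ ^ 2 / 2 := by
  refine ⟨fun y => c y - ‖y‖ ^ 2 / 2, fun x hx => IsLeast.isGLB ⟨?_, ?_⟩⟩
  · obtain ⟨y, hy, hxy⟩ := h.exists_right x hx
    refine ⟨y, hy, ?_⟩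
    dsimp only
    rw [sq_dist_half]
    linarith
  · rintro _ ⟨y, hy, rfl⟩
    dsimp only
    rw [sq_dist_half]
    linarith [h.inner_le x hx y hy]

end IsLegendrePair

lemma conj_add_sq_norm (hM : IsCompact M) (hne : M.Nonempty) {φ : E → ℝ}
    (hφ : ContinuousOn φ M) (y : E) :
    conj M φ y + ‖y‖ ^ 2 / 2 = legendre M (fun x => φ x + ‖x‖ ^ 2 / 2) y := by
  have hf : ContinuousOn (fun x => φ x + ‖x‖ ^ 2 / 2) M := by fun_prop
  obtain ⟨x, hx, hxy⟩ := exists_add_legendre_eq_inner hM hf hne y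
  have hleast : IsLeast ((fun x => dist y x ^ 2 / 2 + φ x) '' M)
      (‖y‖ ^ 2 / 2 - legendre M (fun x => φ x + ‖x‖ ^ 2 / 2) y) := by
    refine ⟨⟨x, hx, ?_⟩, forall_mem_image.2 fun x' hx' => ?_⟩
    · dsimp only
      rw [sq_dist_half, real_inner_comm]
      linarith
    · have := inner_le_add_legendre hM hf hx' y
      rw [sq_dist_half, real_inner_comm]
      linarith
  rw [conj, hleast.csInf_eq]
  ring

lemma IsDSqConvex.exists_supAffine {φ : E → ℝ} (hφ : IsDSqConvex M φ)
    (hM : Bornology.IsBounded M) (hne : M.Nonempty) :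
    ∃ α : M → ℝ, BddAbove (range α) ∧ EqOn (supAffine (↑) α) (fun x => φ x + ‖x‖ ^ 2 / 2) M := by
  have : Nonempty M := hne.to_subtype
  obtain ⟨ψ, hψ⟩ := hφ
  have hle : ∀ x ∈ M, ∀ y : M, ⟪(y : E), x⟫_ℝ - (ψ y + ‖(y : E)‖ ^ 2 / 2) ≤ φ x + ‖x‖ ^ 2 / 2 := by
    intro x hx y
    have : -φ x ≤ dist x y ^ 2 / 2 + ψ y := (hψ x hx).1 (mem_image_of_mem _ y.2)
    rw [sq_dist_half, real_inner_comm] at this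
    linarith
  have hbdd : BddAbove (range fun y : M => -(ψ y + ‖(y : E)‖ ^ 2 / 2)) := by
    obtain ⟨x, hx⟩ := hne
    obtain ⟨R, hR⟩ := hM.exists_norm_le
    refine ⟨R * ‖x‖ + (φ x + ‖x‖ ^ 2 / 2), forall_mem_range.2 fun y => ?_⟩
    have hxy : -(R * ‖x‖) ≤ ⟪(y : E), x⟫_ℝ := (neg_le_neg (by gcongr; exact hR y y.2)).trans
      (neg_le_of_abs_le (abs_real_inner_le_norm _ _))
    linarith [hle x hx y]
  refine ⟨_, hbdd, fun x hx => le_antisymm (supAffine_le (hle x hx)) ?_⟩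
  suffices ‖x‖ ^ 2 / 2 - supAffine (↑) (fun y : M => -(ψ y + ‖(y : E)‖ ^ 2 / 2)) x ≤ -φ x by
    linarith
  refine (hψ x hx).2 (forall_mem_image.2 fun y hy => ?_)
  have := le_supAffine (bddAbove_range_inner_add (isBounded_range_coe hM) hbdd) x ⟨y, hy⟩
  rw [sq_dist_half, real_inner_comm]
  linarith

lemma IsDSqConvex.isLegendrePair {φ : E → ℝ} (hφ : IsDSqConvex M φ) (hM : IsCompact M)
    (hne : M.Nonempty) :
    IsLegendrePair M (fun x => φ x + ‖x‖ ^ 2 / 2) fun y => conj M φ y + ‖y‖ ^ 2 / 2 := by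
  have : Nonempty M := hne.to_subtype
  obtain ⟨α, hα, hφα⟩ := hφ.exists_supAffine hM.isBounded hne
  have hpair := isLegendrePair_supAffine hM (fun y : M => y.2) hα
  have hcont : ContinuousOn φ M := by
    have hsum := (hpair.continuousOn hM.isBounded).congr hφα.symm
    refine (hsum.sub (g := fun x => ‖x‖ ^ 2 / 2) (by fun_prop)).congr fun x _ => ?_
    simp only [Pi.sub_apply, add_sub_cancel_right]
  refine hpair.congr hφα fun y _ => ?_
  rw [legendre_congr hφα]
  exact (conj_add_sq_norm hM hne hcont y).symm

end LegendrePairs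

section Gradients

variable {E : Type*} [NormedAddCommGroup E] [InnerProductSpace ℝ E] [CompleteSpace E] {M : Set E}

lemma hasGradientAt_of_touching {f : E → ℝ} {x y : E}
    (hf : DifferentiableAt ℝ f x) (h : ∀ᶠ x' in 𝓝 x, f x + ⟪x' - x, y⟫_ℝ ≤ f x') :
    HasGradientAt f y x := by
  have hmin : IsLocalMin (fun x' => f x' - ⟪y, x'⟫_ℝ) x := by
    filter_upwards [h] with x' hx'
    rw [inner_sub_left, real_inner_comm, real_inner_comm y x] at hx'
    linarith
  have hzero := hmin.hasFDerivAt_eq_zero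
    (hf.hasGradientAt.hasFDerivAt.sub (hasFDerivAt_inner_left y x))
  have hgrad : gradient f x = y := (InnerProductSpace.toDual ℝ E).injective (sub_eq_zero.1 hzero)
  exact hgrad ▸ hf.hasGradientAt

lemma hasGradientAt_sq_norm_half (x : E) :
    HasGradientAt (fun x : E => ‖x‖ ^ 2 / 2) x x := by
  have hsq := (hasStrictFDerivAt_norm_sq x).hasFDerivAt.mul_const (2⁻¹ : ℝ)
  refine hasGradientAt_iff_hasFDerivAt.2 (hsq.congr_fderiv ?_)
  ext v
  simp

lemma expGrad_eq_gradient {φ : E → ℝ} {x : E}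
    (hφ : DifferentiableAt ℝ (fun x => φ x + ‖x‖ ^ 2 / 2) x) :
    expGrad φ x = gradient (fun x => φ x + ‖x‖ ^ 2 / 2) x := by
  have hsub := hφ.hasGradientAt.hasFDerivAt.sub (hasGradientAt_sq_norm_half x).hasFDerivAt
  simp only [← map_sub, Pi.sub_def, add_sub_cancel_right] at hsub
  rw [expGrad, (hasGradientAt_iff_hasFDerivAt.2 hsub).gradient, add_sub_cancel]

lemma IsLegendrePair.hasGradientAt {f c : E → ℝ} (h : IsLegendrePair M f c) {x y : E}
    (hx : x ∈ interior M) (hf : DifferentiableAt ℝ f x) (hy : y ∈ M)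
    (hxy : f x + c y = ⟪x, y⟫_ℝ) : HasGradientAt f y x := by
  refine hasGradientAt_of_touching hf ?_
  filter_upwards [mem_interior_iff_mem_nhds.1 hx] with x' hx'
  exact h.le_add_inner hx' hy hxy

end Gradients

section Transport

section Integrability

variable {X : Type*} [TopologicalSpace X] [T2Space X] [MeasurableSpace X] [BorelSpace X]
  {μ : Measure X} [IsFiniteMeasure μ] {s : Set X} {f : X → ℝ}

lemma integrable_of_continuousOn (hs : IsCompact s) (hμ : ∀ᵐ x ∂μ, x ∈ s)
    (hf : ContinuousOn f s) : Integrable f μ := by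
  have hint : IntegrableOn f s μ := hf.integrableOn_compact hs
  rwa [IntegrableOn, Measure.restrict_eq_self_of_ae_mem hμ] at hint

lemma integrable_map_of_continuousOn {g : X → X} (hs : IsCompact s) (hg : Measurable g)
    (hgs : ∀ᵐ x ∂μ, g x ∈ s) (hf : ContinuousOn f s) : Integrable f (μ.map g) := by
  have := Measure.isFiniteMeasure_map μ g
  exact integrable_of_continuousOn hs
    ((ae_map_iff hg.aemeasurable hs.isClosed.measurableSet).2 hgs) hf

end Integrability

variable {E : Type*} [NormedAddCommGroup E] [InnerProductSpace ℝ E] [MeasurableSpace E]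
  {M : Set E} {m : Measure E}

lemma IsLegendrePair.ae_add_sub_inner_nonneg {f c : E → ℝ} {g : E → E} (h : IsLegendrePair M f c)
    (hm : ∀ᵐ x ∂m, x ∈ M) (hgM : ∀ᵐ x ∂m, g x ∈ M) :
    0 ≤ᵐ[m] fun x => f x + c (g x) - ⟪x, g x⟫_ℝ := by
  filter_upwards [hm, hgM] with x hx hgx
  exact sub_nonneg.2 (h.inner_le x hx _ hgx)

variable [BorelSpace E] [SecondCountableTopology E] [IsFiniteMeasure m]

lemma integrable_inner {g : E → E} (hM : Bornology.IsBounded M) (hm : ∀ᵐ x ∂m, x ∈ M)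
    (hg : Measurable g) (hgM : ∀ᵐ x ∂m, g x ∈ M) : Integrable (fun x => ⟪x, g x⟫_ℝ) m := by
  obtain ⟨R, hR, hMR⟩ := hM.exists_pos_norm_le
  refine Integrable.of_bound (by fun_prop) (R * R) ?_
  filter_upwards [hm, hgM] with x hx hgx
  exact (norm_inner_le_norm _ _).trans
    (mul_le_mul (hMR x hx) (hMR _ hgx) (norm_nonneg _) hR.le)

lemma integral_sq_dist {g : E → E} (hM : IsCompact M) (hm : ∀ᵐ x ∂m, x ∈ M) (hg : Measurable g)
    (hgM : ∀ᵐ x ∂m, g x ∈ M) :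
    ∫ x, dist x (g x) ^ 2 ∂m =
      ∫ x, ‖x‖ ^ 2 ∂m + ∫ y, ‖y‖ ^ 2 ∂(m.map g) - 2 * ∫ x, ⟪x, g x⟫_ℝ ∂m := by
  have hsq : ContinuousOn (fun x : E => ‖x‖ ^ 2) M := by fun_prop
  have hx := integrable_of_continuousOn hM hm hsq
  have hgx : Integrable (fun x => ‖g x‖ ^ 2) m :=
    (integrable_map_of_continuousOn hM hg hgM hsq).comp_measurable hg
  rw [integral_map hg.aemeasurable (by fun_prop), ← integral_const_mul, ← integral_add hx hgx]
  refine Eq.trans (integral_congr_ae (.of_forall fun x => ?_)) (integral_sub (hx.add hgx)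
    ((integrable_inner hM.isBounded hm hg hgM).const_mul 2))
  simp only [dist_eq_norm, norm_sub_sq_real]
  ring

namespace IsLegendrePair

variable {f c : E → ℝ} {g : E → E}

section Duality

variable (h : IsLegendrePair M f c) (hM : IsCompact M) (hm : ∀ᵐ x ∂m, x ∈ M) (hg : Measurable g)
  (hgM : ∀ᵐ x ∂m, g x ∈ M)
include h hM hm hg hgM

lemma integrable_add_sub_inner : Integrable (fun x => f x + c (g x) - ⟪x, g x⟫_ℝ) m :=
  ((integrable_of_continuousOn hM hm (h.continuousOn hM.isBounded)).add
    ((integrable_map_of_continuousOn hM hg hgM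
      (h.symm.continuousOn hM.isBounded)).comp_measurable hg)).sub
    (integrable_inner hM.isBounded hm hg hgM)

lemma integral_add_sub_inner :
    ∫ x, (f x + c (g x) - ⟪x, g x⟫_ℝ) ∂m =
      ∫ x, f x ∂m + ∫ y, c y ∂(m.map g) - ∫ x, ⟪x, g x⟫_ℝ ∂m := by
  have hf := integrable_of_continuousOn hM hm (h.continuousOn hM.isBounded)
  have hc := integrable_map_of_continuousOn hM hg hgM (h.symm.continuousOn hM.isBounded)
  have hcg : Integrable (fun x => c (g x)) m := hc.comp_measurable hg
  rw [integral_map hg.aemeasurable hc.aestronglyMeasurable, ← integral_add hf hcg]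
  exact integral_sub (hf.add hcg) (integrable_inner hM.isBounded hm hg hgM)

lemma integral_inner_le : ∫ x, ⟪x, g x⟫_ℝ ∂m ≤ ∫ x, f x ∂m + ∫ y, c y ∂(m.map g) := by
  rw [← sub_nonneg, ← h.integral_add_sub_inner hM hm hg hgM]
  exact integral_nonneg_of_ae (h.ae_add_sub_inner_nonneg hm hgM)

lemma integral_inner_eq_iff :
    ∫ x, ⟪x, g x⟫_ℝ ∂m = ∫ x, f x ∂m + ∫ y, c y ∂(m.map g) ↔
      ∀ᵐ x ∂m, f x + c (g x) = ⟪x, g x⟫_ℝ := by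
  rw [eq_comm, ← sub_eq_zero, ← h.integral_add_sub_inner hM hm hg hgM,
    integral_eq_zero_iff_of_nonneg_ae (h.ae_add_sub_inner_nonneg hm hgM)
      (h.integrable_add_sub_inner hM hm hg hgM)]
  exact eventually_congr (.of_forall fun x => sub_eq_zero)

end Duality

end IsLegendrePair

end Transport

section Brenier

variable {E : Type*} [NormedAddCommGroup E] [InnerProductSpace ℝ E] [FiniteDimensional ℝ E]
  [MeasurableSpace E] [BorelSpace E] {M : Set E} {vol m : Measure E} [vol.IsAddHaarMeasure]
  {f c : E → ℝ} {g : E → E}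

lemma measurable_gradient (f : E → ℝ) : Measurable (gradient f) :=
  (InnerProductSpace.toDual ℝ E).symm.continuous.measurable.comp (measurable_fderiv ℝ f)

namespace IsLegendrePair

variable (h : IsLegendrePair M f c) (hM : IsCompact M) (hac : m ≪ vol)
  (hint : ∀ᵐ x ∂m, x ∈ interior M)
include h hM hac hint

lemma ae_differentiableAt : ∀ᵐ x ∂m, DifferentiableAt ℝ f x := by
  obtain ⟨R, hR⟩ := h.exists_lipschitzOnWith hM.isBounded
  filter_upwards [hac.ae_le (hR.ae_differentiableWithinAt_of_mem (μ := vol)), hint] with x hx hxM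
  exact (hx (interior_subset hxM)).differentiableAt (mem_interior_iff_mem_nhds.1 hxM)

lemma ae_hasGradientAt_of_ae_eq
    (hg : ∀ᵐ x ∂m, g x ∈ M ∧ f x + c (g x) = ⟪x, g x⟫_ℝ) :
    ∀ᵐ x ∂m, HasGradientAt f (g x) x := by
  filter_upwards [hg, hint, h.ae_differentiableAt hM hac hint] with x hgx hx hf
  exact h.hasGradientAt hx hf hgx.1 hgx.2

lemma ae_gradient :
    ∀ᵐ x ∂m, gradient f x ∈ M ∧ f x + c (gradient f x) = ⟪x, gradient f x⟫_ℝ := by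
  filter_upwards [hint, h.ae_differentiableAt hM hac hint] with x hx hf
  obtain ⟨y, hy, hxy⟩ := h.exists_right x (interior_subset hx)
  rw [(h.hasGradientAt hx hf hy hxy).gradient]
  exact ⟨hy, hxy⟩

variable [IsFiniteMeasure m]

lemma integral_inner_gradient :
    ∫ x, ⟪x, gradient f x⟫_ℝ ∂m = ∫ x, f x ∂m + ∫ y, c y ∂(m.map (gradient f)) := by
  have hgrad := h.ae_gradient hM hac hint
  exact (h.integral_inner_eq_iff hM (hint.mono fun _ hx => interior_subset hx)
    (measurable_gradient f) (hgrad.mono fun _ hx => hx.1)).2 (hgrad.mono fun _ hx => hx.2)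

lemma ae_hasGradientAt_of_map_eq (hg : Measurable g) (hgM : ∀ᵐ x ∂m, g x ∈ M)
    (hmap : m.map g = m.map (gradient f))
    (hle : ∫ x, ⟪x, gradient f x⟫_ℝ ∂m ≤ ∫ x, ⟪x, g x⟫_ℝ ∂m) :
    ∀ᵐ x ∂m, HasGradientAt f (g x) x := by
  have hmM : ∀ᵐ x ∂m, x ∈ M := hint.mono fun _ hx => interior_subset hx
  refine h.ae_hasGradientAt_of_ae_eq hM hac hint (hgM.and ?_)
  refine (h.integral_inner_eq_iff hM hmM hg hgM).1
    ((h.integral_inner_le hM hmM hg hgM).antisymm ?_)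
  rwa [hmap, ← h.integral_inner_gradient hM hac hint]

lemma exists_isOptimalTransportMap (hne : M.Nonempty) :
    ∃ g, IsOptimalTransportMap M m (m.map (gradient f)) g ∧ g =ᵐ[m] gradient f := by
  classical
  obtain ⟨y₀, hy₀⟩ := hne
  have hmM : ∀ᵐ x ∂m, x ∈ M := hint.mono fun _ hx => interior_subset hx
  let g : E → E := (gradient f ⁻¹' M).piecewise (gradient f) fun _ => y₀
  have hg : Measurable g := (measurable_gradient f).piecewise
    (measurable_gradient f hM.isClosed.measurableSet) measurable_const
  have hgM : ∀ x, g x ∈ M := fun x => by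
    by_cases hx : x ∈ gradient f ⁻¹' M
    · rwa [show g x = gradient f x from piecewise_eq_of_mem _ _ _ hx]
    · rwa [show g x = y₀ from piecewise_eq_of_notMem _ _ _ hx]
  have hae : g =ᵐ[m] gradient f := (h.ae_gradient hM hac hint).mono fun x hx =>
    piecewise_eq_of_mem _ _ _ hx.1
  have hmap : m.map g = m.map (gradient f) := Measure.map_congr hae
  refine ⟨g, ⟨hg, fun x _ => hgM x, hmap, fun k hk hkM hkmap => ?_⟩, hae⟩
  have hkM' : ∀ᵐ x ∂m, k x ∈ M := hmM.mono fun x hx => hkM hx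
  have hinner : ∫ x, ⟪x, g x⟫_ℝ ∂m = ∫ x, ⟪x, gradient f x⟫_ℝ ∂m :=
    integral_congr_ae (hae.mono fun x hx => congrArg (inner ℝ x) hx)
  have hle := h.integral_inner_le hM hmM hk hkM'
  rw [hkmap, ← h.integral_inner_gradient hM hac hint] at hle
  rw [integral_sq_dist hM hmM hg (.of_forall hgM), integral_sq_dist hM hmM hk hkM', hmap, hkmap,
    hinner]
  linarith

lemma ae_hasGradientAt_of_isOptimalTransportMap
    (hg : IsOptimalTransportMap M m (m.map (gradient f)) g) :
    ∀ᵐ x ∂m, HasGradientAt f (g x) x := by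
  have hmM : ∀ᵐ x ∂m, x ∈ M := hint.mono fun _ hx => interior_subset hx
  have hgM : ∀ᵐ x ∂m, g x ∈ M := hmM.mono fun x hx => hg.mapsTo hx
  refine h.ae_hasGradientAt_of_map_eq hM hac hint hg.measurable hgM hg.map_eq ?_
  rcases M.eq_empty_or_nonempty with rfl | hne
  · simp [ae_eq_bot.1 (eventually_false_iff_eq_bot.1 hmM)]
  obtain ⟨k, hk, hae⟩ := h.exists_isOptimalTransportMap hM hac hint hne
  have hinner : ∫ x, ⟪x, k x⟫_ℝ ∂m = ∫ x, ⟪x, gradient f x⟫_ℝ ∂m :=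
    integral_congr_ae (hae.mono fun x hx => congrArg (inner ℝ x) hx)
  have hopt := hg.optimal k hk.measurable hk.mapsTo hk.map_eq
  rw [integral_sq_dist hM hmM hg.measurable hgM,
    integral_sq_dist hM hmM hk.measurable (hmM.mono fun x hx => hk.mapsTo hx), hg.map_eq,
    hk.map_eq, hinner] at hopt
  linarith

lemma ae_gradient_eq_of_map_eq {f' c' : E → ℝ} (h' : IsLegendrePair M f' c')
    (hmap : m.map (gradient f') = m.map (gradient f)) : gradient f' =ᵐ[m] gradient f := by
  have hmM : ∀ᵐ x ∂m, x ∈ M := hint.mono fun _ hx => interior_subset hx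
  have hgrad := h.ae_gradient hM hac hint
  have hgrad' := h'.ae_gradient hM hac hint
  have hle := h'.integral_inner_le hM hmM (measurable_gradient f) (hgrad.mono fun _ hx => hx.1)
  rw [← hmap, ← h'.integral_inner_gradient hM hac hint] at hle
  have := h.ae_hasGradientAt_of_map_eq hM hac hint (measurable_gradient f')
    (hgrad'.mono fun _ hx => hx.1) hmap hle
  exact this.mono fun x hx => hx.gradient.symm

end IsLegendrePair

end Brenier

lemma IsLegendrePair.map_expGrad {E : Type*} [NormedAddCommGroup E] [InnerProductSpace ℝ E]
    [FiniteDimensional ℝ E] [MeasurableSpace E] [BorelSpace E] {M : Set E} {vol m : Measure E}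
    [vol.IsAddHaarMeasure] {φ c : E → ℝ}
    (h : IsLegendrePair M (fun x => φ x + ‖x‖ ^ 2 / 2) c) (hM : IsCompact M) (hac : m ≪ vol)
    (hint : ∀ᵐ x ∂m, x ∈ interior M) :
    m.map (expGrad φ) = m.map (gradient fun x => φ x + ‖x‖ ^ 2 / 2) :=
  Measure.map_congr ((h.ae_differentiableAt hM hac hint).mono fun _ hx => expGrad_eq_gradient hx)

section Cells

lemma eqOn_of_ae_eq_of_subset_support {X Y : Type*} [TopologicalSpace X] [MeasurableSpace X]
    [TopologicalSpace Y] [T2Space Y] {μ : Measure X} {U : Set X} {f g : X → Y} (hU : IsOpen U)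
    (hUμ : U ⊆ μ.support) (hf : ContinuousOn f U) (hg : ContinuousOn g U)
    (hfg : ∀ᵐ x ∂μ, x ∈ U → f x = g x) : EqOn f g U := by
  intro x hx
  by_contra hne
  have hxU := hU.mem_nhds hx
  have hmem : {y | ¬(y ∈ U → f y = g y)} ∈ 𝓝 x := by
    filter_upwards [hxU, ((hf.continuousAt hxU).ne_iff_eventually_ne (hg.continuousAt hxU)).1 hne]
      with y hyU hy hy'
    exact hy (hy' hyU)
  exact ((Measure.mem_support_iff_forall x).1 (hUμ hx) _ hmem).ne' hfg

lemma ae_mem_iUnion_of_tsum_measure_eq_one {X ι : Type*} [MeasurableSpace X] [Countable ι]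
    {μ : Measure X} [IsProbabilityMeasure μ] {U : ι → Set X} (hU : ∀ i, MeasurableSet (U i))
    (hdisj : Pairwise fun i j => Disjoint (U i) (U j)) (hsum : ∑' i, μ (U i) = 1) :
    ∀ᵐ x ∂μ, x ∈ ⋃ i, U i :=
  (prob_compl_eq_zero_iff (.iUnion hU)).2 (by rw [measure_iUnion hdisj hU, hsum])

lemma map_eq_sum_dirac {X Y ι : Type*} [MeasurableSpace X] [MeasurableSpace Y] [Countable ι]
    {μ : Measure X} {U : ι → Set X} {g : X → Y} {z : ι → Y} (hU : ∀ i, MeasurableSet (U i))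
    (hdisj : Pairwise fun i j => Disjoint (U i) (U j)) (hcover : ∀ᵐ x ∂μ, x ∈ ⋃ i, U i)
    (hg : AEMeasurable g μ) (hgz : ∀ i, ∀ x ∈ U i, g x = z i) :
    μ.map g = Measure.sum fun i => μ (U i) • Measure.dirac (z i) := by
  have hsum : μ = Measure.sum fun i => μ.restrict (U i) := by
    rw [← Measure.restrict_iUnion hdisj hU, Measure.restrict_eq_self_of_ae_mem hcover]
  conv_lhs => rw [hsum]
  rw [Measure.map_sum (hsum ▸ hg)]
  congr 1 with i : 1
  rw [Measure.map_congr (g := fun _ => z i) ((ae_restrict_iff' (hU i)).2 (.of_forall (hgz i))),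
    Measure.map_const, Measure.restrict_apply_univ]

variable {E : Type*} [NormedAddCommGroup E] [InnerProductSpace ℝ E] [FiniteDimensional ℝ E]
  [MeasurableSpace E] [BorelSpace E] {M : Set E} {vol m : Measure E} [vol.IsAddHaarMeasure]

lemma ae_mem_interior (hMc : IsClosed M) (hMconv : Convex ℝ M) (hac : m ≪ vol)
    (hm : ∀ᵐ x ∂m, x ∈ M) : ∀ᵐ x ∂m, x ∈ interior M := by
  have hfront : ∀ᵐ x ∂m, x ∉ frontier M :=
    measure_eq_zero_iff_ae_notMem.1 (hac (hMconv.addHaar_frontier vol))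
  filter_upwards [hm, hfront] with x hx hxf
  rw [hMc.frontier_eq] at hxf
  exact of_not_not fun hxi => hxf ⟨hx, hxi⟩

variable {ι : Type*} {z : ι → E} {α : ι → ℝ}

lemma measure_openCell (hMconv : Convex ℝ M) (hac : m ≪ vol)
    (hm : ∀ᵐ x ∂m, x ∈ M) (h : ∀ x, BddAbove (range fun i => ⟪z i, x⟫_ℝ + α i)) (i : ι) :
    m (openCell M z α i) = m (contactSet z α i) := by
  have hnull : m (frontier (M ∩ contactSet z α i)) = 0 :=
    hac ((hMconv.inter (convex_contactSet h i)).addHaar_frontier vol)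
  rw [openCell, measure_congr (interior_ae_eq_of_null_frontier hnull), inter_comm]
  exact measure_inter_conull hm

variable [Countable ι] [IsProbabilityMeasure m] {w : ι → ℝ≥0∞} (hMconv : Convex ℝ M)
  (hac : m ≪ vol) (hm : ∀ᵐ x ∂m, x ∈ M) (hz : Function.Injective z)
  (h : ∀ x, BddAbove (range fun i => ⟪z i, x⟫_ℝ + α i)) (hα : ∀ i, m (contactSet z α i) = w i)
  (hw : ∑' i, w i = 1)
include hMconv hac hm hz h hα hw

lemma ae_mem_iUnion_openCell : ∀ᵐ x ∂m, x ∈ ⋃ i, openCell M z α i := by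
  refine ae_mem_iUnion_of_tsum_measure_eq_one (fun i => (isOpen_openCell i).measurableSet)
    (pairwise_disjoint_openCell hz h) ?_
  simp only [measure_openCell hMconv hac hm h, hα, hw]

lemma map_gradient_supAffine : m.map (gradient (supAffine z α)) = discreteMeasure z w := by
  rw [map_eq_sum_dirac (fun i => (isOpen_openCell i).measurableSet)
    (pairwise_disjoint_openCell hz h) (ae_mem_iUnion_openCell hMconv hac hm hz h hα hw)
    (measurable_gradient _).aemeasurable fun i x hx => (hasGradientAt_supAffine hx).gradient]
  simp only [measure_openCell hMconv hac hm h, hα, discreteMeasure]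

end Cells

section ConjugateMeasures

variable {E : Type*} [NormedAddCommGroup E] [InnerProductSpace ℝ E] {M U : Set E} {f c : E → ℝ}
  {x p : E}

namespace IsLegendrePair

lemma eq_of_add_eq_inner_of_mem (h : IsLegendrePair M f c) (hU : IsOpen U) (hUM : U ⊆ M)
    (hp : ∀ y ∈ U, f y + c p = ⟪y, p⟫_ℝ) (hx : x ∈ M) {y : E} (hy : y ∈ U)
    (hxy : f y + c x = ⟪y, x⟫_ℝ) : x = p := by
  refine eq_of_inner_add_le_of_mem_interior (c := -c x) (c' := -c p) (hU.subset_interior_iff.2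
    Subset.rfl hy) (fun y' hy' => ?_) ?_
  · linarith [h.inner_le y' (hUM hy') x hx, hp y' hy', real_inner_comm x y', real_inner_comm p y']
  · linarith [hp y hy, real_inner_comm x y, real_inner_comm p y]

variable [FiniteDimensional ℝ E] [MeasurableSpace E] [BorelSpace E] {vol m : Measure E}
  [vol.IsAddHaarMeasure] (h : IsLegendrePair M f c) (hM : IsCompact M) (hac : m ≪ vol)
  (hint : ∀ᵐ x ∂m, x ∈ interior M) (hU : IsOpen U) (hUM : U ⊆ M) (hUm : U ⊆ m.support)
  (hgrad : ∀ᵐ x ∂m, x ∈ U → gradient f x = p)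
include h hM hac hint hU hUM hUm hgrad

lemma add_eq_inner_of_ae_gradient_eq : ∀ y ∈ U, f y + c p = ⟪y, p⟫_ℝ := by
  have hf : ContinuousOn f U := (h.continuousOn hM.isBounded).mono hUM
  refine eqOn_of_ae_eq_of_subset_support hU hUm (by fun_prop) (by fun_prop) ?_
  filter_upwards [hgrad, h.ae_gradient hM hac hint] with y hy hfy hyU
  rw [← hy hyU]
  exact hfy.2

/-- On `U` the function `f` is affine with slope `p`, so that `gradient c x ∈ U` forces `x = p`. -/
lemma ae_gradient_right_notMem [NullSingletonClass vol] : ∀ᵐ x ∂m, gradient c x ∉ U := by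
  have hp := h.add_eq_inner_of_ae_gradient_eq hM hac hint hU hUM hUm hgrad
  have hne : ∀ᵐ x ∂m, x ≠ p := measure_eq_zero_iff_ae_notMem.1 (hac (measure_singleton p))
  filter_upwards [hint, h.symm.ae_gradient hM hac hint, hne] with x hx hcx hxp hxU
  refine hxp (h.eq_of_add_eq_inner_of_mem hU hUM hp (interior_subset hx) hxU ?_)
  rw [add_comm, hcx.2, real_inner_comm]

end IsLegendrePair

end ConjugateMeasures

section DualProblem

lemma isCompact_setOf_lipschitzWith_eq_zero {X : Type*} [PseudoMetricSpace X] [CompactSpace X]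
    (K : ℝ≥0) (x₀ : X) :
    IsCompact {a : BoundedContinuousFunction X ℝ | LipschitzWith K a ∧ a x₀ = 0} := by
  refine BoundedContinuousFunction.arzela_ascoli₂
    (Metric.closedBall 0 (K * Metric.diam (univ : Set X))) (isCompact_closedBall 0 _) _ ?_
    (fun a x ha => ?_) ?_
  · have hcoe : Continuous fun a : BoundedContinuousFunction X ℝ => (a : X → ℝ) :=
      continuous_pi fun x => (BoundedContinuousFunction.lipschitz_eval_const x).continuous
    exact ((isClosed_setOfPred_lipschitzWith K).preimage hcoe).inter
      (isClosed_eq ((continuous_apply x₀).comp hcoe) continuous_const)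
  · rw [Metric.mem_closedBall, ← ha.2]
    refine (ha.1.dist_le_mul x x₀).trans (mul_le_mul_of_nonneg_left ?_ K.2)
    exact Metric.dist_le_diam_of_mem isCompact_univ.isBounded trivial trivial
  · exact (LipschitzWith.uniformEquicontinuous _ K fun a => a.2.1).equicontinuous

variable {E : Type*} [NormedAddCommGroup E] [InnerProductSpace ℝ E] [MeasurableSpace E]
  [BorelSpace E] {ι : Type*} [MeasurableSpace ι] {M : Set E} {z : ι → E} {m : Measure E}
  {p : Measure ι}

/-- The objective of the dual transport problem from `m` to the image of `p` under `z`, as a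
function of the values `α i` of the negative of the potential at the points `z i`. -/
noncomputable def dualCost (m : Measure E) (z : ι → E) (p : Measure ι) (α : ι → ℝ) : ℝ :=
  ∫ x, supAffine z α x ∂m - ∫ i, α i ∂p

variable [Countable ι] [DiscreteMeasurableSpace ι] [IsProbabilityMeasure m]
  [IsProbabilityMeasure p] (hM : IsCompact M) (hm : ∀ᵐ x ∂m, x ∈ M) {α β : ι → ℝ}
include hM hm

lemma dualCost_le_add (hz : Bornology.IsBounded (range z)) (hα : Bornology.IsBounded (range α))
    (hβ : Bornology.IsBounded (range β)) {s : E → ℝ} (hs : Integrable s m)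
    (hsup : ∀ᵐ x ∂m, supAffine z β x ≤ supAffine z α x + s x) {r : ι → ℝ} (hr : Integrable r p)
    (hle : ∀ i, α i ≤ β i + r i) :
    dualCost m z p β ≤ dualCost m z p α + ∫ x, s x ∂m + ∫ i, r i ∂p := by
  have hint : ∀ {γ : ι → ℝ}, Bornology.IsBounded (range γ) →
      Integrable (supAffine z γ) m ∧ Integrable γ p := by
    intro γ hγ
    obtain ⟨C, hC⟩ := hγ.exists_norm_le
    exact ⟨integrable_of_continuousOn hM hm (continuous_supAffine hz hγ.bddAbove).continuousOn,
      .of_bound .of_discrete C (ae_of_all _ fun i => hC _ (mem_range_self i))⟩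
  have hsupint := integral_mono_ae (hint hβ).1 ((hint hα).1.add hs) hsup
  have hleint := integral_mono (hint hα).2 ((hint hβ).2.add hr) hle
  rw [integral_add' (hint hα).1 hs] at hsupint
  rw [integral_add' (hint hβ).2 hr] at hleint
  rw [dualCost, dualCost]
  linarith

variable [Nonempty ι]

lemma lipschitzWith_dualCost (hz : Bornology.IsBounded (range z)) (y : ι → M) :
    LipschitzWith 2 fun a : BoundedContinuousFunction M ℝ => dualCost m z p fun i => a (y i) := by
  have hbdd (a : BoundedContinuousFunction M ℝ) : Bornology.IsBounded (range fun i => a (y i)) :=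
    a.isBounded_range.subset (range_comp_subset_range y a)
  refine LipschitzWith.of_le_add_mul 2 fun a b => ?_
  have hab (i : ι) : |a (y i) - b (y i)| ≤ dist a b :=
    Real.dist_eq (a (y i)) (b (y i)) ▸ BoundedContinuousFunction.dist_coe_le_dist (y i)
  refine (dualCost_le_add hM hm hz (hbdd b) (hbdd a) (integrable_const (dist a b))
    (ae_of_all _ fun x => supAffine_le fun i => ?_) (integrable_const (dist a b))
    fun i => ?_).trans_eq ?_
  · have := le_supAffine (bddAbove_range_inner_add hz (hbdd b).bddAbove) x i
    linarith [(abs_le.1 (hab i)).2]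
  · linarith [(abs_le.1 (hab i)).1]
  · simp only [integral_const, probReal_univ, one_smul, NNReal.coe_ofNat]
    ring

/-- The witness is, up to sign and a constant, the Legendre transform of `supAffine z α`. -/
lemma exists_lipschitzWith_dualCost_le (hzM : ∀ i, z i ∈ M) {R : ℝ≥0} (hR : ∀ x ∈ M, ‖x‖ ≤ R)
    (x₀ : M) (hα : Bornology.IsBounded (range α)) :
    ∃ a : E → ℝ, LipschitzWith R a ∧ a x₀ = 0 ∧
      dualCost m z p (fun i => a (z i)) ≤ dualCost m z p α := by
  have hz : Bornology.IsBounded (range z) := hM.isBounded.subset (range_subset_iff.2 hzM)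
  have hf := (continuous_supAffine hz hα.bddAbove).continuousOn (s := M)
  set l := legendre M (supAffine z α)
  have hl : LipschitzWith R l := lipschitzWith_supAffine (bddAbove_range_inner_add
    (isBounded_range_coe hM.isBounded) (bddAbove_range_neg hM hf)) fun x => hR x x.2
  have ha : LipschitzWith R fun x => l x₀ - l x :=
    .of_dist_le_mul fun x y => by simpa only [dist_sub_left] using hl.dist_le_mul x y
  have hab : Bornology.IsBounded (range fun i => l x₀ - l (z i)) := by
    rw [range_comp' (fun x => l x₀ - l x) z]
    exact ha.isBounded_image hz
  refine ⟨fun x => l x₀ - l x, ha, sub_self _, ?_⟩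
  refine (dualCost_le_add hM hm hz hα hab (integrable_const (l x₀)) ?_
    (integrable_const (-l x₀)) fun i => ?_).trans_eq ?_
  · filter_upwards [hm] with x hx
    refine supAffine_le fun i => ?_
    have := inner_le_add_legendre hM hf hx (z i)
    rw [real_inner_comm]
    linarith
  · obtain ⟨x, -, hx⟩ := exists_add_legendre_eq_inner hM hf ⟨x₀, x₀.2⟩ (z i)
    have := le_supAffine (bddAbove_range_inner_add hz hα.bddAbove) x i
    rw [real_inner_comm] at this
    linarith
  · simp only [integral_const, probReal_univ, one_smul]
    ring

lemma exists_isMinOn_dualCost (hzM : ∀ i, z i ∈ M) :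
    ∃ α, Bornology.IsBounded (range α) ∧
      IsMinOn (dualCost m z p) {β | Bornology.IsBounded (range β)} α := by
  have hz : Bornology.IsBounded (range z) := hM.isBounded.subset (range_subset_iff.2 hzM)
  obtain ⟨R, hR0, hR⟩ := hM.isBounded.exists_pos_norm_le
  lift R to ℝ≥0 using hR0.le
  have := isCompact_iff_compactSpace.1 hM
  set y : ι → M := fun i => ⟨z i, hzM i⟩
  set x₀ := y (Classical.arbitrary ι)
  obtain ⟨a, -, ha⟩ := (isCompact_setOf_lipschitzWith_eq_zero R x₀).exists_isMinOn
    ⟨0, (LipschitzWith.const 0).weaken zero_le, rfl⟩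
    (lipschitzWith_dualCost (m := m) (p := p) hM hm hz y).continuous.continuousOn
  refine ⟨fun i => a (y i), a.isBounded_range.subset (range_comp_subset_range y a),
    fun β hβ => ?_⟩
  obtain ⟨b, hb, hb0, hbβ⟩ := exists_lipschitzWith_dualCost_le hM hm (p := p) hzM hR x₀ hβ
  have hbM : LipschitzWith R fun x : M => b x := fun x y => hb x y
  exact (ha (show BoundedContinuousFunction.mkOfCompact ⟨_, hbM.continuous⟩ ∈ _ from
    ⟨hbM, hb0⟩)).trans hbβ

end DualProblem

section PrescribedMasses

lemma supAffine_add_indicator_le {E ι : Type*} [NormedAddCommGroup E] [InnerProductSpace ℝ E]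
    {z : ι → E} {α : ι → ℝ} (h : ∀ x, BddAbove (range fun i => ⟪z i, x⟫_ℝ + α i)) (i : ι) {t : ℝ}
    (ht : 0 ≤ t) (x : E) :
    supAffine z (α + ({i} : Set ι).indicator fun _ => t) x ≤ supAffine z α x +
      {x | supAffine z α x ≤ ⟪z i, x⟫_ℝ + α i + t}.indicator (fun _ => t) x := by
  have : Nonempty ι := ⟨i⟩
  set V := {x | supAffine z α x ≤ ⟪z i, x⟫_ℝ + α i + t}
  refine supAffine_le fun j => ?_
  have hj := le_supAffine h x j
  have hnonneg : 0 ≤ V.indicator (fun _ => t) x := indicator_nonneg (fun _ _ => ht) x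
  rw [Pi.add_apply]
  by_cases hji : j ∈ ({i} : Set ι)
  · by_cases hx : x ∈ V
    · rw [indicator_of_mem hx, indicator_of_mem hji]
      linarith
    · have hlt : ⟪z i, x⟫_ℝ + α i + t < supAffine z α x := not_le.1 hx
      rw [indicator_of_mem hji, mem_singleton_iff.1 hji]
      linarith
  · rw [indicator_of_notMem hji]
    linarith

lemma nonempty_of_tsum_ne_zero {R ι : Type*} [AddCommMonoid R] [TopologicalSpace R] {f : ι → R}
    (h : ∑' i, f i ≠ 0) : Nonempty ι :=
  not_isEmpty_iff.1 fun _ => h tsum_empty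

lemma eq_of_le_of_tsum_le {ι : Type*} {u v : ι → ℝ≥0∞} (hle : ∀ i, u i ≤ v i)
    (hu : ∑' i, u i ≠ ∞) (hsum : ∑' i, v i ≤ ∑' i, u i) : u = v := by
  by_contra hne
  obtain ⟨i, hi⟩ := Function.ne_iff.1 hne
  exact (ENNReal.tsum_lt_tsum hu hle ((hle i).lt_of_ne hi)).not_ge hsum

variable {E : Type*} [NormedAddCommGroup E] [InnerProductSpace ℝ E] [MeasurableSpace E]
  [BorelSpace E] {ι : Type*} {M : Set E} {z : ι → E} {α : ι → ℝ} {m : Measure E}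

lemma tendsto_measure_supAffine_le [IsFiniteMeasure m] (hz : Bornology.IsBounded (range z))
    (hα : BddAbove (range α)) (i : ι) :
    Tendsto (fun t => m {x | supAffine z α x ≤ ⟪z i, x⟫_ℝ + α i + t}) (𝓝[>] 0)
      (𝓝 (m (contactSet z α i))) := by
  have hinter : ⋂ t > 0, {x | supAffine z α x ≤ ⟪z i, x⟫_ℝ + α i + t} = contactSet z α i := by
    ext x
    simp only [mem_iInter, mem_ofPred_eq, ← le_iff_forall_pos_le_add]
    exact (le_supAffine (bddAbove_range_inner_add hz hα) x i).ge_iff_eq'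
  rw [← hinter]
  refine tendsto_measure_biInter_gt (fun t _ => ?_) (fun t t' _ htt' x hx => hx.out.trans ?_)
    ⟨1, one_pos, measure_ne_top m _⟩
  · exact (isClosed_le (continuous_supAffine hz hα)
      (by fun_prop)).measurableSet.nullMeasurableSet
  · gcongr

section Minimizer

variable [Countable ι] [MeasurableSpace ι] [DiscreteMeasurableSpace ι] {p : Measure ι}
  [IsProbabilityMeasure m] [IsProbabilityMeasure p] (hM : IsCompact M) (hm : ∀ᵐ x ∂m, x ∈ M)
  (hz : Bornology.IsBounded (range z)) (hα : Bornology.IsBounded (range α))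
  (hmin : IsMinOn (dualCost m z p) {β | Bornology.IsBounded (range β)} α)
include hM hm hz hα hmin

lemma measureReal_singleton_le_of_isMinOn_dualCost (i : ι) {t : ℝ} (ht : 0 < t) :
    p.real {i} ≤ m.real {x | supAffine z α x ≤ ⟪z i, x⟫_ℝ + α i + t} := by
  set V := {x | supAffine z α x ≤ ⟪z i, x⟫_ℝ + α i + t}
  have hVm : MeasurableSet V :=
    (isClosed_le (continuous_supAffine hz hα.bddAbove) (by fun_prop)).measurableSet
  set δ : ι → ℝ := ({i} : Set ι).indicator fun _ => t
  have hδ : Bornology.IsBounded (range (α + δ)) := by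
    obtain ⟨C, hC⟩ := hα.exists_norm_le
    refine isBounded_iff_forall_norm_le.2 ⟨C + t, forall_mem_range.2 fun j => ?_⟩
    refine (norm_add_le _ _).trans (add_le_add (hC _ (mem_range_self j)) ?_)
    exact (norm_indicator_le_norm_self _ j).trans_eq (Real.norm_of_nonneg ht.le)
  have hδint : Integrable δ p := (integrable_const t).indicator (measurableSet_singleton i)
  have hvar := dualCost_le_add hM hm hz hα hδ ((integrable_const t).indicator hVm)
    (ae_of_all _ fun x => supAffine_add_indicator_le
      (bddAbove_range_inner_add hz hα.bddAbove) i ht.le x)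
    hδint.neg fun j => (add_neg_cancel_right (α j) (δ j)).ge
  simp only [Pi.neg_apply] at hvar
  rw [integral_neg, integral_indicator_const t hVm,
    integral_indicator_const t (measurableSet_singleton i), smul_eq_mul, smul_eq_mul] at hvar
  have hαδ : dualCost m z p α ≤ dualCost m z p (α + δ) := hmin hδ
  exact le_of_mul_le_mul_right (by linarith) ht

lemma measure_singleton_le_measure_contactSet (i : ι) : p {i} ≤ m (contactSet z α i) := by
  refine ge_of_tendsto (tendsto_measure_supAffine_le hz hα.bddAbove i) ?_
  filter_upwards [self_mem_nhdsWithin] with t ht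
  rw [← ENNReal.toReal_le_toReal (measure_ne_top _ _) (measure_ne_top _ _)]
  exact measureReal_singleton_le_of_isMinOn_dualCost hM hm hz hα hmin i ht

end Minimizer

lemma exists_measure_contactSet_eq [Countable ι] [FiniteDimensional ℝ E]
    {vol : Measure E} [vol.IsAddHaarMeasure] [IsProbabilityMeasure m] (hM : IsCompact M)
    (hMconv : Convex ℝ M) (hac : m ≪ vol) (hm : ∀ᵐ x ∂m, x ∈ M) (hz : Function.Injective z)
    (hzM : ∀ i, z i ∈ M) {w : ι → ℝ≥0∞} (hw : ∑' i, w i = 1) :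
    ∃ α : ι → ℝ, BddAbove (range α) ∧ ∀ i, m (contactSet z α i) = w i := by
  have : Nonempty ι := nonempty_of_tsum_ne_zero (hw ▸ one_ne_zero)
  let _ : MeasurableSpace ι := ⊤
  let p : PMF ι := ⟨w, hw ▸ ENNReal.summable.hasSum⟩
  have hzb : Bornology.IsBounded (range z) := hM.isBounded.subset (range_subset_iff.2 hzM)
  obtain ⟨α, hα, hmin⟩ := exists_isMinOn_dualCost (m := m) (p := p.toMeasure) hM hm hzM
  have hbdd := bddAbove_range_inner_add hzb hα.bddAbove
  have hle (i : ι) : w i ≤ m (contactSet z α i) :=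
    (p.toMeasure_apply_singleton i (measurableSet_singleton i)).symm.trans_le
      (measure_singleton_le_measure_contactSet hM hm hzb hα hmin i)
  refine ⟨α, hα.bddAbove, fun i => (congrFun (eq_of_le_of_tsum_le hle ?_ ?_) i).symm⟩
  · rw [hw]
    exact ENNReal.one_ne_top
  · rw [hw]
    calc ∑' i, m (contactSet z α i) = ∑' i, m (openCell M z α i) :=
          tsum_congr fun i => (measure_openCell hMconv hac hm hbdd i).symm
      _ = m (⋃ i, openCell M z α i) := (measure_iUnion (pairwise_disjoint_openCell hz hbdd)
          fun i => (isOpen_openCell i).measurableSet).symm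
      _ ≤ 1 := prob_le_one

end PrescribedMasses

section ConvexFrontier

variable {E : Type*} [NormedAddCommGroup E] [InnerProductSpace ℝ E] {K C : Set E}

lemma norm_sub_le_of_inner_sub_nonpos {u u' v v' : E} (h : ⟪u - v, v' - v⟫_ℝ ≤ 0)
    (h' : ⟪u' - v', v - v'⟫_ℝ ≤ 0) : ‖v - v'‖ ≤ ‖u - u'‖ := by
  have hinner : ‖v - v'‖ ^ 2 ≤ ⟪u - u', v - v'⟫_ℝ := by
    rw [← real_inner_self_eq_norm_sq]
    have hsplit : ⟪u - u', v - v'⟫_ℝ - ⟪v - v', v - v'⟫_ℝ =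
        -⟪u - v, v' - v⟫_ℝ - ⟪u' - v', v - v'⟫_ℝ := by
      simp only [inner_sub_left, inner_sub_right]
      ring
    linarith
  have hmul := hinner.trans (real_inner_le_norm _ _)
  rw [sq] at hmul
  by_contra! hlt
  exact hmul.not_gt (mul_lt_mul_of_pos_right hlt ((norm_nonneg _).trans_lt hlt))

lemma exists_lipschitzWith_eq_iff_inner_sub_nonpos (hK : IsComplete K) (hKconv : Convex ℝ K)
    (hne : K.Nonempty) :
    ∃ P : E → E, LipschitzWith 1 P ∧
      ∀ u v, P u = v ↔ v ∈ K ∧ ∀ y ∈ K, ⟪u - v, y - v⟫_ℝ ≤ 0 := by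
  choose P hPK hP using exists_norm_eq_iInf_of_complete_convex hne hK hKconv
  have hvar (u : E) : ∀ y ∈ K, ⟪u - P u, y - P u⟫_ℝ ≤ 0 :=
    (norm_eq_iInf_iff_real_inner_le_zero hKconv (hPK u)).1 (hP u)
  refine ⟨P, LipschitzWith.of_dist_le_mul fun u u' => ?_, fun u v => ⟨?_, fun ⟨hv, hvv⟩ => ?_⟩⟩
  · rw [NNReal.coe_one, one_mul, dist_eq_norm, dist_eq_norm]
    exact norm_sub_le_of_inner_sub_nonpos (hvar u _ (hPK u')) (hvar u' _ (hPK u))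
  · rintro rfl
    exact ⟨hPK u, hvar u⟩
  · have := norm_sub_le_of_inner_sub_nonpos (hvar u v hv) (hvv _ (hPK u))
    rwa [sub_self, norm_zero, norm_le_zero_iff, sub_eq_zero] at this

lemma exists_add_smul_mem_frontier (hC : Bornology.IsBounded C) {x v : E} (hx : x ∈ C)
    (hv : v ≠ 0) : ∃ t : ℝ, 0 ≤ t ∧ x + t • v ∈ frontier C := by
  have hγ : Continuous fun t : ℝ => x + |t| • v := by fun_prop
  obtain ⟨R, hR⟩ := hC.exists_norm_le
  have hleave : (fun t : ℝ => x + |t| • v) ⁻¹' C ≠ univ := by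
    intro huniv
    have hnorm : ‖x + |(R + ‖x‖ + 1) / ‖v‖| • v‖ ≤ R := hR _ (huniv.ge trivial)
    have hfar : R + ‖x‖ + 1 ≤ ‖|(R + ‖x‖ + 1) / ‖v‖| • v‖ := by
      rw [norm_smul, Real.norm_eq_abs, abs_abs]
      exact (div_le_iff₀ (norm_pos_iff.2 hv)).1 (le_abs_self _)
    linarith [norm_le_add_norm_add (|(R + ‖x‖ + 1) / ‖v‖| • v) x,
      add_comm x (|(R + ‖x‖ + 1) / ‖v‖| • v) ▸ hnorm]
  obtain ⟨t, ht⟩ := nonempty_frontier_iff.2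
    ⟨⟨0, show x + |(0 : ℝ)| • v ∈ C by rwa [abs_zero, zero_smul, add_zero]⟩, hleave⟩
  exact ⟨|t|, abs_nonneg t, hγ.frontier_preimage_subset C ht⟩

/-- The nearest-point projection is constant on outward normal rays, and these leave `C`. -/
lemma exists_lipschitzWith_frontier_subset_image (hK : IsComplete K) (hKconv : Convex ℝ K)
    (hC : IsCompact C) (hKC : K ⊆ C) :
    ∃ P : E → E, LipschitzWith 1 P ∧ frontier K ⊆ P '' frontier C := by
  rcases K.eq_empty_or_nonempty with rfl | hne
  · exact ⟨id, LipschitzWith.id, by rw [frontier_empty]; exact empty_subset _⟩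
  obtain ⟨P, hPlip, hP⟩ := exists_lipschitzWith_eq_iff_inner_sub_nonpos hK hKconv hne
  have hPu (u : E) : P u ∈ K ∧ ∀ y ∈ K, ⟪u - P u, y - P u⟫_ℝ ≤ 0 := (hP u (P u)).1 rfl
  refine ⟨P, hPlip, ?_⟩
  have hcompl : P '' Kᶜ ⊆ P '' frontier C := by
    rintro _ ⟨u, hu, rfl⟩
    have hne : u - P u ≠ 0 := fun h => hu (sub_eq_zero.1 h ▸ (hPu u).1)
    obtain ⟨t, ht, htC⟩ := exists_add_smul_mem_frontier hC.isBounded (hKC (hPu u).1) hne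
    refine ⟨_, htC, (hP _ _).2 ⟨(hPu u).1, fun y hy => ?_⟩⟩
    rw [add_sub_cancel_left, real_inner_smul_left]
    exact mul_nonpos_of_nonneg_of_nonpos ht ((hPu u).2 y hy)
  have hclosed : IsClosed (P '' frontier C) :=
    ((hC.of_isClosed_subset isClosed_frontier hC.isClosed.frontier_subset).image
      hPlip.continuous).isClosed
  intro x hx
  have hPx : P x = x := (hP x x).2 ⟨hK.isClosed.frontier_subset hx, fun y _ => by
    rw [sub_self, inner_zero_left]⟩
  have hxcl : P x ∈ closure (P '' Kᶜ) := image_closure_subset_closure_image hPlip.continuous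
    (mem_image_of_mem P (frontier_eq_closure_inter_closure.le hx).2)
  rw [← hPx]
  exact closure_minimal hcompl hclosed hxcl

lemma isClosed_setOf_abs_inner_le {κ : Type*} (b : κ → E) (R : ℝ) :
    IsClosed {x | ∀ i, |⟪b i, x⟫_ℝ| ≤ R} := by
  simp only [ofPred_forall]
  exact isClosed_iInter fun i => isClosed_le (by fun_prop) continuous_const

lemma frontier_setOf_abs_inner_le_subset {κ : Type*} [Finite κ] (b : κ → E) (R : ℝ) :
    frontier {x | ∀ i, |⟪b i, x⟫_ℝ| ≤ R} ⊆
      ⋃ i, ({x | ∀ i, |⟪b i, x⟫_ℝ| ≤ R} ∩ {x | ⟪b i, x⟫_ℝ = R} ∪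
        {x | ∀ i, |⟪b i, x⟫_ℝ| ≤ R} ∩ {x | ⟪b i, x⟫_ℝ = -R}) := by
  rintro x hx
  rw [(isClosed_setOf_abs_inner_le b R).frontier_eq] at hx
  obtain ⟨i, hi⟩ : ∃ i, |⟪b i, x⟫_ℝ| = R := by
    by_contra! hne
    have hopen : IsOpen {x | ∀ i, |⟪b i, x⟫_ℝ| < R} := by
      simp only [ofPred_forall]
      exact isOpen_iInter_of_finite fun i => isOpen_lt (by fun_prop) continuous_const
    exact hx.2 (interior_maximal (fun y hy i => (hy i).le) hopen
      fun i => (hx.1 i).lt_of_ne (hne i))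
  exact mem_iUnion.2 ⟨i, (eq_or_eq_neg_of_abs_eq hi).imp (⟨hx.1, ·⟩) (⟨hx.1, ·⟩)⟩

variable [FiniteDimensional ℝ E] [MeasurableSpace E] [BorelSpace E]

lemma hausdorffMeasure_inter_hyperplane_lt_top {S : Set E} (hS : Bornology.IsBounded S) {v : E}
    (hv : v ≠ 0) (s : ℝ) :
    Measure.hausdorffMeasure ((Module.finrank ℝ E : ℝ) - 1) (S ∩ {x | ⟪v, x⟫_ℝ = s}) < ∞ := by
  rcases (S ∩ {x | ⟪v, x⟫_ℝ = s}).eq_empty_or_nonempty with hempty | ⟨x₀, -, hx₀⟩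
  · rw [hempty, measure_empty]
    exact ENNReal.zero_lt_top
  have hdim : (Module.finrank ℝ E : ℝ) - 1 = Module.finrank ℝ (ℝ ∙ v)ᗮ := by
    rw [← (ℝ ∙ v).finrank_add_finrank_orthogonal, finrank_span_singleton hv]
    push_cast
    ring
  have hiso : Isometry fun y : (ℝ ∙ v)ᗮ => x₀ + (y : E) :=
    (isometry_add_left x₀).comp isometry_subtype_coe
  have himage : S ∩ {x | ⟪v, x⟫_ℝ = s} ⊆
      (fun y : (ℝ ∙ v)ᗮ => x₀ + (y : E)) '' ((fun y => x₀ + (y : E)) ⁻¹' S) := by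
    rintro x ⟨hxS, hx⟩
    have horth : x - x₀ ∈ (ℝ ∙ v)ᗮ := by
      rw [Submodule.mem_orthogonal_singleton_iff_inner_right, inner_sub_right, hx.out, hx₀.out,
        sub_self]
    have hadd : x₀ + (x - x₀) = x := add_sub_cancel x₀ x
    exact ⟨⟨x - x₀, horth⟩, by rwa [mem_preimage, hadd], hadd⟩
  refine (measure_mono himage).trans_lt ?_
  rw [hdim, hiso.hausdorffMeasure_image (.inl (Nat.cast_nonneg _))]
  exact (hiso.antilipschitz.isBounded_preimage hS).measure_lt_top

lemma exists_isCompact_superset_hausdorffMeasure_frontier_lt_top {S : Set E}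
    (hS : Bornology.IsBounded S) :
    ∃ C, IsCompact C ∧ S ⊆ C ∧
      Measure.hausdorffMeasure ((Module.finrank ℝ E : ℝ) - 1) (frontier C) < ∞ := by
  obtain ⟨R, hR⟩ := hS.exists_norm_le
  set b := stdOrthonormalBasis ℝ E
  set C : Set E := {x | ∀ i, |⟪b i, x⟫_ℝ| ≤ R}
  have hclosed : IsClosed C := isClosed_setOf_abs_inner_le b R
  have hbdd : Bornology.IsBounded C := by
    refine isBounded_iff_forall_norm_le.2 ⟨∑ _ : Fin (Module.finrank ℝ E), R, fun x hx => ?_⟩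
    rw [← b.sum_repr' x]
    refine norm_sum_le_of_le _ fun i _ => ?_
    rw [norm_smul, b.norm_eq_one, mul_one]
    exact hx i
  refine ⟨C, Metric.isCompact_of_isClosed_isBounded hclosed hbdd, fun x hx i => ?_, ?_⟩
  · refine (abs_real_inner_le_norm _ _).trans ?_
    rw [b.norm_eq_one, one_mul]
    exact hR x hx
  · refine (measure_mono (frontier_setOf_abs_inner_le_subset b R)).trans_lt
      ((measure_iUnion_fintype_le _ _).trans_lt
        (ENNReal.sum_lt_top.2 fun i _ => measure_union_lt_top ?_ ?_)) <;>
    exact hausdorffMeasure_inter_hyperplane_lt_top hbdd (b.orthonormal.ne_zero i) _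

lemma hausdorffMeasure_frontier_lt_top [Nontrivial E] (hK : IsCompact K) (hKconv : Convex ℝ K) :
    Measure.hausdorffMeasure ((Module.finrank ℝ E : ℝ) - 1) (frontier K) < ∞ := by
  obtain ⟨C, hC, hKC, hCfin⟩ :=
    exists_isCompact_superset_hausdorffMeasure_frontier_lt_top hK.isBounded
  obtain ⟨P, hP, hsub⟩ := exists_lipschitzWith_frontier_subset_image hK.isComplete hKconv hC hKC
  have hdim : (0 : ℝ) ≤ Module.finrank ℝ E - 1 :=
    sub_nonneg.2 (Nat.one_le_cast.2 Module.finrank_pos)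
  refine (measure_mono hsub).trans_lt ((hP.hausdorffMeasure_image_le hdim _).trans_lt ?_)
  rw [ENNReal.coe_one, ENNReal.one_rpow, one_mul]
  exact hCfin

end ConvexFrontier

section FiniteCells

lemma sdiff_iUnion_interior_subset {X ι : Type*} [TopologicalSpace X] {M : Set X} {A : ι → Set X}
    (hM : M ⊆ ⋃ i, A i) : M \ ⋃ i, interior (M ∩ A i) ⊆ ⋃ i, frontier (M ∩ A i) := by
  rintro x ⟨hxM, hx⟩
  obtain ⟨i, hi⟩ := mem_iUnion.1 (hM hxM)
  exact mem_iUnion.2 ⟨i, subset_closure ⟨hxM, hi⟩, fun hint => hx (mem_iUnion.2 ⟨i, hint⟩)⟩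

variable {E : Type*} [NormedAddCommGroup E] [InnerProductSpace ℝ E] {ι : Type*} [Finite ι]
  {z : ι → E} {α : ι → ℝ}

lemma bddAbove_range_inner_add_of_finite (z : ι → E) (α : ι → ℝ) (x : E) :
    BddAbove (range fun i => ⟪z i, x⟫_ℝ + α i) :=
  (finite_range _).bddAbove

lemma isConvexPolytope_contactSet (hz : Function.Injective z) (α : ι → ℝ) (i : ι) :
    IsConvexPolytope (contactSet z α i) := by
  have hfin : (range fun j : {j // j ≠ i} => (z j - z i, α i - α j)).Finite := finite_range _
  refine ⟨hfin.toFinset, ?_, ?_⟩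
  · simp only [Finite.mem_toFinset, forall_mem_range]
    exact fun j => sub_ne_zero.2 (hz.ne j.2)
  · rw [contactSet_eq_iInter (bddAbove_range_inner_add_of_finite z α)]
    ext x
    simp only [mem_iInter, mem_ofPred_eq, Finite.mem_toFinset, forall_mem_range, Subtype.forall]
    refine forall_congr' fun j => ⟨fun h _ => h, fun h => ?_⟩
    by_cases hj : j = i
    · rw [hj, sub_self, sub_self, inner_zero_left]
    · exact h hj

variable [Nonempty ι]

lemma iUnion_contactSet (z : ι → E) (α : ι → ℝ) : ⋃ i, contactSet z α i = univ := by
  refine eq_univ_of_forall fun x => ?_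
  obtain ⟨i, hi⟩ := Finite.exists_max fun i => ⟪z i, x⟫_ℝ + α i
  exact mem_iUnion.2 ⟨i, (mem_contactSet_iff (bddAbove_range_inner_add_of_finite z α)).2 hi⟩

/-- Completing the square, `-2 (⟪z i, x⟫ + α i) + ‖x‖²` is the power distance of `x` to the sphere
of squared radius `‖z i‖² + 2 α i` around `z i`, up to a common constant that makes the squared
radii nonnegative. -/
lemma exists_contactSet_eq_setOf_sq_sub_sq_le (z : ι → E) (α : ι → ℝ) :
    ∃ r : ι → ℝ, (∀ i, 0 ≤ r i) ∧ ∀ i, contactSet z α i =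
      {x | ∀ j, ‖x - z i‖ ^ 2 - r i ^ 2 ≤ ‖x - z j‖ ^ 2 - r j ^ 2} := by
  obtain ⟨i₀, hi₀⟩ := Finite.exists_min fun i => ‖z i‖ ^ 2 + 2 * α i
  refine ⟨fun i => √(‖z i‖ ^ 2 + 2 * α i - (‖z i₀‖ ^ 2 + 2 * α i₀)),
    fun i => Real.sqrt_nonneg _, fun i => ext fun x => ?_⟩
  rw [mem_contactSet_iff (bddAbove_range_inner_add_of_finite z α)]
  refine forall_congr' fun j => ?_
  rw [Real.sq_sqrt (sub_nonneg.2 (hi₀ i)), Real.sq_sqrt (sub_nonneg.2 (hi₀ j)),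
    norm_sub_sq_real, norm_sub_sq_real, real_inner_comm, real_inner_comm x (z i)]
  constructor <;> intro h <;> linarith

lemma isLaguerreTessellation_contactSet (hz : Function.Injective z) (α : ι → ℝ) :
    IsLaguerreTessellation z (contactSet z α) where
  cells := exists_contactSet_eq_setOf_sq_sub_sq_le z α
  cover := iUnion_contactSet z α
  disjoint := pairwise_disjoint_interior_contactSet hz (bddAbove_range_inner_add_of_finite z α)

lemma hausdorffMeasure_sdiff_iUnion_openCell_lt_top [FiniteDimensional ℝ E] [Nontrivial E]
    [MeasurableSpace E] [BorelSpace E] {M : Set E} (hM : IsCompact M) (hMconv : Convex ℝ M)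
    (z : ι → E) (α : ι → ℝ) :
    Measure.hausdorffMeasure ((Module.finrank ℝ E : ℝ) - 1) (M \ ⋃ i, openCell M z α i) < ∞ := by
  have h := bddAbove_range_inner_add_of_finite z α
  have := Fintype.ofFinite ι
  have hsub : M \ ⋃ i, openCell M z α i ⊆ ⋃ i, frontier (M ∩ contactSet z α i) :=
    sdiff_iUnion_interior_subset (subset_univ M |>.trans (iUnion_contactSet z α).ge)
  refine (measure_mono hsub).trans_lt ((measure_iUnion_fintype_le _ _).trans_lt
    (ENNReal.sum_lt_top.2 fun i _ => ?_))
  exact hausdorffMeasure_frontier_lt_top (hM.inter_right (isClosed_contactSet h i))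
    (hMconv.inter (convex_contactSet h i))

end FiniteCells

section ConjugateOfDiscrete

variable {E : Type*} [NormedAddCommGroup E] [InnerProductSpace ℝ E] [FiniteDimensional ℝ E]
  [MeasurableSpace E] [BorelSpace E] {M : Set E} {vol m μ ν : Measure E} [vol.IsAddHaarMeasure]

lemma IsConjugateMeasure.isProbabilityMeasure [IsProbabilityMeasure m]
    (hν : IsConjugateMeasure M m μ ν) : IsProbabilityMeasure ν := by
  obtain ⟨φ, -, -, rfl⟩ := hν
  exact Measure.isProbabilityMeasure_map (measurable_id.add (measurable_gradient _)).aemeasurable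

lemma IsConjugateMeasure.exists_isLegendrePair (hν : IsConjugateMeasure M m μ ν) (hM : IsCompact M)
    (hac : m ≪ vol) (hint : ∀ᵐ x ∂m, x ∈ interior M) (hne : M.Nonempty) :
    ∃ f c, IsLegendrePair M f c ∧ m.map (gradient f) = μ ∧ m.map (gradient c) = ν := by
  obtain ⟨φ, hφ, rfl, rfl⟩ := hν
  have h := hφ.isLegendrePair hM hne
  exact ⟨_, _, h, (h.map_expGrad hM hac hint).symm, (h.symm.map_expGrad hM hac hint).symm⟩

namespace IsLegendrePair

variable {f c : E → ℝ} (h : IsLegendrePair M f c) (hM : IsCompact M) (hac : m ≪ vol)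
  (hint : ∀ᵐ x ∂m, x ∈ interior M)
include h hM hac hint

lemma exists_isConjugateMeasure : ∃ ν, IsConjugateMeasure M m (m.map (gradient f)) ν := by
  have hf : (fun x => f x - ‖x‖ ^ 2 / 2 + ‖x‖ ^ 2 / 2) = f := funext fun x => sub_add_cancel _ _
  refine ⟨_, fun x => f x - ‖x‖ ^ 2 / 2, h.isDSqConvex, ?_, rfl⟩
  rw [map_expGrad (hf.symm ▸ h) hM hac hint, hf]

lemma measure_compl_sdiff_iUnion_of_isConjugateMeasure [NullSingletonClass vol] [IsFiniteMeasure m]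
    (hne : M.Nonempty) {ι : Type*} [Countable ι] {U : ι → Set E} {z : ι → E}
    (hU : ∀ i, IsOpen (U i)) (hUM : ∀ i, U i ⊆ M) (hUm : ∀ i, U i ⊆ m.support)
    (hgrad : ∀ i, ∀ x ∈ U i, gradient f x = z i)
    (hν : IsConjugateMeasure M m (m.map (gradient f)) ν) : ν (M \ ⋃ i, U i)ᶜ = 0 := by
  obtain ⟨f', c', h', hmap, rfl⟩ := hν.exists_isLegendrePair hM hac hint hne
  have hgrad' (i : ι) : ∀ᵐ x ∂m, x ∈ U i → gradient f' x = z i :=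
    (h.ae_gradient_eq_of_map_eq hM hac hint h' hmap).mono fun x hx hxU =>
      hx.trans (hgrad i x hxU)
  have hout : ∀ᵐ x ∂m, ∀ i, gradient c' x ∉ U i := ae_all_iff.2 fun i =>
    h'.ae_gradient_right_notMem hM hac hint (hU i) (hUM i) (hUm i) (hgrad' i)
  rw [Measure.map_apply (measurable_gradient c')
    (hM.diff (isOpen_iUnion hU)).measurableSet.compl, measure_eq_zero_iff_ae_notMem]
  filter_upwards [hout, h'.symm.ae_gradient hM hac hint] with x hx hxM
  exact not_not.2 ⟨hxM.1, fun hxU => (mem_iUnion.1 hxU).elim hx⟩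

end IsLegendrePair

end ConjugateOfDiscrete

end ConjugationMap

open ConjugationMap in
theorem theorem4p2_general {E : Type*} [NormedAddCommGroup E] [InnerProductSpace ℝ E]
    [FiniteDimensional ℝ E] [Nontrivial E] [MeasurableSpace E] [BorelSpace E] {M : Set E}
    (hM : IsCompact M) (hMconv : Convex ℝ M) {vol m : Measure E} [vol.IsAddHaarMeasure]
    [IsProbabilityMeasure m] (hac : m ≪ vol) (hsupp : m.support = M) {ι : Type*} [Countable ι]
    {z : ι → E} (hz : Function.Injective z) (hzM : ∀ i, z i ∈ M) {w : ι → ℝ≥0∞}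
    (hw : ∑' i, w i = 1) :
    (∃ g, IsOptimalTransportMap M m (discreteMeasure z w) g) ∧
    (∃ ν, IsConjugateMeasure M m (discreteMeasure z w) ν) ∧
    (∃ α : ι → ℝ, BddAbove (Set.range α) ∧ ∀ i, m (contactSet z α i) = w i) ∧
    ∀ α : ι → ℝ, BddAbove (Set.range α) → (∀ i, m (contactSet z α i) = w i) →
      (∀ i, IsOpen (openCell M z α i) ∧ Convex ℝ (openCell M z α i) ∧ openCell M z α i ⊆ M ∧
        m (openCell M z α i) = w i) ∧
      (Pairwise fun i j => Disjoint (openCell M z α i) (openCell M z α j)) ∧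
      IsDSqConvex M (fun x => supAffine z α x - ‖x‖ ^ 2 / 2) ∧
      (∀ i, ∀ x ∈ openCell M z α i, HasGradientAt (supAffine z α) (z i) x) ∧
      (∀ g, IsOptimalTransportMap M m (discreteMeasure z w) g →
        (∀ᵐ x ∂m, HasGradientAt (supAffine z α) (g x) x) ∧
        ∀ i, ∀ᵐ x ∂m, x ∈ openCell M z α i → g x = z i) ∧
      IsCompact (M \ ⋃ i, openCell M z α i) ∧
      m (M \ ⋃ i, openCell M z α i) = 0 ∧
      (∀ ν, IsConjugateMeasure M m (discreteMeasure z w) ν →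
        IsProbabilityMeasure ν ∧ ν (M \ ⋃ i, openCell M z α i)ᶜ = 0) ∧
      (Finite ι →
        (∀ i, IsConvexPolytope (contactSet z α i)) ∧
        IsLaguerreTessellation z (contactSet z α) ∧
        (∀ i, w i ≠ 0 → (interior (contactSet z α i)).Nonempty) ∧
        Measure.hausdorffMeasure ((Module.finrank ℝ E : ℝ) - 1)
          (M \ ⋃ i, openCell M z α i) < ∞) := by
  have hm : ∀ᵐ x ∂m, x ∈ M := hsupp ▸ Measure.support_mem_ae
  have hint := ae_mem_interior hM.isClosed hMconv hac hm
  have : Nonempty ι := nonempty_of_tsum_ne_zero (hw ▸ one_ne_zero)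
  have hne : M.Nonempty := ⟨_, hzM (Classical.arbitrary ι)⟩
  have hzb : Bornology.IsBounded (Set.range z) := hM.isBounded.subset (Set.range_subset_iff.2 hzM)
  obtain ⟨α₀, hα₀, hmass₀⟩ := exists_measure_contactSet_eq hM hMconv hac hm hz hzM hw
  have hpair₀ := isLegendrePair_supAffine hM hzM hα₀
  have hmap₀ := map_gradient_supAffine hMconv hac hm hz (bddAbove_range_inner_add hzb hα₀) hmass₀ hw
  refine ⟨hmap₀ ▸ (hpair₀.exists_isOptimalTransportMap hM hac hint hne).imp fun _ => And.left,
    hmap₀ ▸ hpair₀.exists_isConjugateMeasure hM hac hint, ⟨α₀, hα₀, hmass₀⟩, fun α hα hmass => ?_⟩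
  have h := bddAbove_range_inner_add hzb hα
  have hpair := isLegendrePair_supAffine hM hzM hα
  have hcell (i : ι) := (measure_openCell hMconv hac hm h i).trans (hmass i)
  have hcover := ae_mem_iUnion_openCell hMconv hac hm hz h hmass hw
  rw [← map_gradient_supAffine hMconv hac hm hz h hmass hw]
  refine ⟨fun i => ⟨isOpen_openCell i, convex_openCell hMconv h i, openCell_subset i, hcell i⟩,
    pairwise_disjoint_openCell hz h, hpair.isDSqConvex, fun i x => hasGradientAt_supAffine,
    fun g hg => ?_, hM.diff (isOpen_iUnion isOpen_openCell),
    measure_mono_null (Set.sdiff_subset_compl M _) hcover,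
    fun ν hν => ⟨hν.isProbabilityMeasure, ?_⟩,
    fun _ => ⟨isConvexPolytope_contactSet hz α, isLaguerreTessellation_contactSet hz α,
      fun i hi => (nonempty_of_measure_ne_zero ((hcell i).trans_ne hi)).mono
        (interior_mono Set.inter_subset_right),
      hausdorffMeasure_sdiff_iUnion_openCell_lt_top hM hMconv z α⟩⟩
  · have hgrad := hpair.ae_hasGradientAt_of_isOptimalTransportMap hM hac hint hg
    exact ⟨hgrad, fun i => hgrad.mono fun x hx hxU => hx.unique (hasGradientAt_supAffine hxU)⟩
  · exact hpair.measure_compl_sdiff_iUnion_of_isConjugateMeasure hM hac hint hne isOpen_openCell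
      openCell_subset (fun i => hsupp ▸ openCell_subset i)
      (fun i x hx => (hasGradientAt_supAffine hx).gradient) hν

theorem theorem4p2 {n : ℕ} (hn : 1 ≤ n) (M : Set (EuclideanSpace ℝ (Fin n)))
    (hMcompact : IsCompact M) (hMconvex : Convex ℝ M)
    (m : Measure (EuclideanSpace ℝ (Fin n))) [IsProbabilityMeasure m]
    (hm_ac : m ≪ volume) (hm_supp : m.support = M)
    {ι : Type*} [Countable ι] (z : ι → EuclideanSpace ℝ (Fin n)) (hz : Function.Injective z)
    (hzM : ∀ i, z i ∈ M) (w : ι → ℝ≥0∞) (hw : ∑' i, w i = 1) :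
    -- the optimal transport map, the conjugate measure and suitable numbers `α i` exist
    (∃ g, ConjugationMap.IsOptimalTransportMap M m (ConjugationMap.discreteMeasure z w) g) ∧
    (∃ ν, ConjugationMap.IsConjugateMeasure M m (ConjugationMap.discreteMeasure z w) ν) ∧
    (∃ α : ι → ℝ, BddAbove (Set.range α) ∧ ∀ i, m (ConjugationMap.contactSet z α i) = w i) ∧
    -- and every such choice of the numbers `α i` has the asserted properties
    ∀ α : ι → ℝ, BddAbove (Set.range α) → (∀ i, m (ConjugationMap.contactSet z α i) = w i) →
      -- the sets `U i`
      (∀ i, IsOpen (ConjugationMap.openCell M z α i) ∧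
        Convex ℝ (ConjugationMap.openCell M z α i) ∧
        ConjugationMap.openCell M z α i ⊆ M ∧
        m (ConjugationMap.openCell M z α i) = w i) ∧
      (Pairwise fun i j =>
        Disjoint (ConjugationMap.openCell M z α i) (ConjugationMap.openCell M z α j)) ∧
      -- `φ₁` is the potential of the optimal transport map, whose value on `U i` is `z i`
      ConjugationMap.IsDSqConvex M (fun x => ConjugationMap.supAffine z α x - ‖x‖ ^ 2 / 2) ∧
      (∀ i, ∀ x ∈ ConjugationMap.openCell M z α i,
        HasGradientAt (ConjugationMap.supAffine z α) (z i) x) ∧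
      (∀ g, ConjugationMap.IsOptimalTransportMap M m (ConjugationMap.discreteMeasure z w) g →
        (∀ᵐ x ∂m, HasGradientAt (ConjugationMap.supAffine z α) (g x) x) ∧
        ∀ i, ∀ᵐ x ∂m, x ∈ ConjugationMap.openCell M z α i → g x = z i) ∧
      -- the compact `m`-null set that carries the conjugate measure
      IsCompact (M \ ⋃ i, ConjugationMap.openCell M z α i) ∧
      m (M \ ⋃ i, ConjugationMap.openCell M z α i) = 0 ∧
      (∀ ν, ConjugationMap.IsConjugateMeasure M m (ConjugationMap.discreteMeasure z w) ν →
        IsProbabilityMeasure ν ∧ ν (M \ ⋃ i, ConjugationMap.openCell M z α i)ᶜ = 0) ∧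
      -- finitely many atoms
      (Finite ι →
        (∀ i, ConjugationMap.IsConvexPolytope (ConjugationMap.contactSet z α i)) ∧
        ConjugationMap.IsLaguerreTessellation z (ConjugationMap.contactSet z α) ∧
        (∀ i, w i ≠ 0 → (interior (ConjugationMap.contactSet z α i)).Nonempty) ∧
        Measure.hausdorffMeasure ((n : ℝ) - 1)
          (M \ ⋃ i, ConjugationMap.openCell M z α i) < ∞) := by
  have : Nonempty (Fin n) := ⟨⟨0, hn⟩⟩
  simpa only [finrank_euclideanSpace_fin] using
    theorem4p2_general hMcompact hMconvex hm_ac hm_supp hz hzM hw
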